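/- Let $I=(-1,1)$ and $\Omega=I\times I$. Let $H^1_0(\Omega)$ be the closure of $C_c^\infty(\Omega)$ in $H^1(\Omega)$, normed by $\|v\|_{H^1_0(\Omega)}=\|\nabla v\|_{L^2(\Omega)^2}$. For $q\ge 4$ let $\mathcal V_q=\mathbb P_q(\Omega)\cap H^1_0(\Omega)$, where $\mathbb P_q(\Omega)$ is the space of polynomials of total degree at most $q$ restricted to $\Omega$. Let $L_k$ be the Legendre polynomial of degree $k$ with $L_k(1)=1$, put $$\varphi_k(x)=\sqrt{k-\tfrac12}\int_x^1 L_{k-1}(s)\,ds\quad(k\ge 2),\qquad \Phi_m(x_1,x_2)=\varphi_{m_1}(x_1)\,\varphi_{m_2}(x_2),\qquad |m|=m_1+m_2,$$ for $m=(m_1,m_2)\in\mathbb N^2$ with $m_1,m_2\ge 2$, and let $$\mathcal V_q^c=\operatorname{clos}_{H^1_0(\Omega)}\operatorname{span}\{\Phi_m : m_1,m_2\ge 2,\ |m|>q\}.$$ **Proposition.** For every $q\ge 4$ one has $H^1_0(\Omega)=\mathcal V_q\oplus\mathcal V_q^c$ (algebraic direct sum), so that every $v\in H^1_0(\Omega)$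 can be written uniquely as $v=v_q+z_q$ with $v_q\in\mathcal V_q$ and $z_q\in\mathcal V_q^c$. Moreover, there is a constant $C_2>0$, independent of $q$ and $v$, such that for all $q\ge 4$ and all $v=v_q+z_q$ with $v_q\in\mathcal V_q$, $z_q\in\mathcal V_q^c$, $$\|z_q\|_{H^1_0(\Omega)}\le C_2\,q\,\|v\|_{H^1_0(\Omega)}.$$ -/

import Mathlib

open MeasureTheory Set
open scoped ContDiff

noncomputable section

namespace BabuskaShen

/-- The reference square `Ω = (-1,1) × (-1,1)`. -/
def Omega : Set (ℝ × ℝ) := Ioo (-1 : ℝ) 1 ×ˢ Ioo (-1 : ℝ) 1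

/-- The real Hilbert space `L²(Ω)`. -/
abbrev L2 : Type := Lp ℝ 2 ((volume : Measure (ℝ × ℝ)).restrict Omega)

/-- `w` is the element of `L²(Ω)` given by the restriction of the function `f` to `Ω`. -/
def Represents (w : L2) (f : ℝ × ℝ → ℝ) : Prop :=
  (w : ℝ × ℝ → ℝ) =ᵐ[(volume : Measure (ℝ × ℝ)).restrict Omega] f

lemma represents_zero : Represents 0 (fun _ => 0) := Lp.coeFn_zero _ _ _

lemma Represents.add {u v : L2} {f g : ℝ × ℝ → ℝ} (hu : Represents u f) (hv : Represents v g) :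
    Represents (u + v) (fun x => f x + g x) := by
  unfold Represents at *
  filter_upwards [Lp.coeFn_add u v, hu, hv] with x h1 h2 h3
  rw [h1, Pi.add_apply, h2, h3]

lemma Represents.smul {u : L2} {f : ℝ × ℝ → ℝ} (c : ℝ) (hu : Represents u f) :
    Represents (c • u) (fun x => c * f x) := by
  unfold Represents at *
  filter_upwards [Lp.coeFn_smul c u, hu] with x h1 h2
  rw [h1, Pi.smul_apply, h2, smul_eq_mul]

/-- A test function on `Ω`: smooth, with compact support contained in `Ω`. -/
structure IsTestFunction (f : ℝ × ℝ → ℝ) : Prop where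
  smooth : ContDiff ℝ ∞ f
  compact : HasCompactSupport f
  support : tsupport f ⊆ Omega

lemma isTestFunction_zero : IsTestFunction (fun _ => 0) :=
  ⟨contDiff_const, HasCompactSupport.zero, by
    have h : tsupport (fun _ : ℝ × ℝ => (0 : ℝ)) = ∅ := tsupport_eq_empty_iff.2 rfl
    rw [h]; exact empty_subset _⟩

lemma IsTestFunction.add {f g : ℝ × ℝ → ℝ} (hf : IsTestFunction f) (hg : IsTestFunction g) :
    IsTestFunction (fun x => f x + g x) :=
  ⟨hf.smooth.add hg.smooth, hf.compact.add hg.compact,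
    (tsupport_add f g).trans (union_subset hf.support hg.support)⟩

lemma IsTestFunction.const_mul {f : ℝ × ℝ → ℝ} (c : ℝ) (hf : IsTestFunction f) :
    IsTestFunction (fun x => c * f x) :=
  ⟨contDiff_const.mul hf.smooth, hf.compact.mul_left,
    (tsupport_mul_subset_right (f := fun _ : ℝ × ℝ => c) (g := f)).trans hf.support⟩

/-- The subspace of `L²(Ω) × L²(Ω) × L²(Ω)` formed by the triples `(f, ∂₁ f, ∂₂ f)`, where `f`
ranges over the test functions on `Ω`. -/
def testTriples : Submodule ℝ (L2 × L2 × L2) where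
  carrier := {w | ∃ f : ℝ × ℝ → ℝ, IsTestFunction f ∧ Represents w.1 f ∧
    Represents w.2.1 (fun x => fderiv ℝ f x (1, 0)) ∧
    Represents w.2.2 (fun x => fderiv ℝ f x (0, 1))}
  zero_mem' := ⟨fun _ => 0, isTestFunction_zero, represents_zero,
    by simpa using represents_zero, by simpa using represents_zero⟩
  add_mem' := by
    rintro u v ⟨f, hf, hf0, hf1, hf2⟩ ⟨g, hg, hg0, hg1, hg2⟩
    have key : ∀ x, fderiv ℝ (fun y => f y + g y) x = fderiv ℝ f x + fderiv ℝ g x := fun x =>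
      fderiv_fun_add (hf.smooth.differentiable (by simp) x) (hg.smooth.differentiable (by simp) x)
    refine ⟨fun x => f x + g x, hf.add hg, hf0.add hg0, ?_, ?_⟩
    · simpa [key] using hf1.add hg1
    · simpa [key] using hf2.add hg2
  smul_mem' := by
    rintro c u ⟨f, hf, hf0, hf1, hf2⟩
    have key : ∀ x, fderiv ℝ (fun y => c * f y) x = c • fderiv ℝ f x := fun x =>
      fderiv_const_mul (hf.smooth.differentiable (by simp) x) c
    refine ⟨fun x => c * f x, hf.const_mul c, hf0.smul c, ?_, ?_⟩
    · simpa [key] using hf1.smul c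
    · simpa [key] using hf2.smul c

/-- The Sobolev space `H¹₀(Ω)`: the closure of the test functions with respect to `L²(Ω)`
convergence of the function and of its first order partial derivatives. An element is recorded as
the triple `u = (u, ∂₁ u, ∂₂ u)` of the `L²(Ω)` function and its two weak partial derivatives
(which are determined by the function). The norm that this type inherits from the ambient product
is not used below; see `energyNorm`. -/
abbrev H10 : Type := (testTriples.topologicalClosure : Submodule ℝ (L2 × L2 × L2))

/-- The function underlying an element of `H¹₀(Ω)`, as an element of `L²(Ω)`. -/
def toL2 : H10 →ₗ[ℝ] L2 :=
  LinearMap.fst ℝ L2 (L2 × L2) ∘ₗ testTriples.topologicalClosure.subtype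

/-- The gradient `∇ : H¹₀(Ω) → L²(Ω)²`, the target with its Hilbert space norm. -/
def grad : H10 →ₗ[ℝ] WithLp 2 (L2 × L2) :=
  (WithLp.linearEquiv 2 ℝ (L2 × L2)).symm.toLinearMap ∘ₗ
    LinearMap.snd ℝ L2 (L2 × L2) ∘ₗ testTriples.topologicalClosure.subtype

/-- The norm `‖u‖_{H¹₀(Ω)} = ‖∇ u‖_{L²(Ω)²}`. -/
def energyNorm (u : H10) : ℝ := ‖grad u‖

/-- The closure of a subspace of `H¹₀(Ω)` with respect to `energyNorm`. -/
def energyClosure (S : Submodule ℝ H10) : Submodule ℝ H10 where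
  carrier := {z | ∀ ε : ℝ, 0 < ε → ∃ s ∈ S, energyNorm (z - s) < ε}
  zero_mem' := fun ε hε => ⟨0, S.zero_mem, by simpa [energyNorm] using hε⟩
  add_mem' := by
    intro a b ha hb ε hε
    obtain ⟨s, hs, h1⟩ := ha (ε / 2) (half_pos hε)
    obtain ⟨t, ht, h2⟩ := hb (ε / 2) (half_pos hε)
    refine ⟨s + t, S.add_mem hs ht, ?_⟩
    have h3 : energyNorm (a + b - (s + t)) ≤ energyNorm (a - s) + energyNorm (b - t) := by
      unfold energyNorm
      rw [add_sub_add_comm, map_add]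
      exact norm_add_le _ _
    linarith
  smul_mem' := by
    intro c a ha ε hε
    obtain ⟨s, hs, h1⟩ := ha (ε / (|c| + 1)) (by positivity)
    refine ⟨c • s, S.smul_mem c hs, ?_⟩
    have h2 : energyNorm (c • a - c • s) = |c| * energyNorm (a - s) := by
      unfold energyNorm
      rw [map_sub, map_sub, map_smul, map_smul, ← smul_sub, norm_smul, Real.norm_eq_abs]
    have h3 : 0 ≤ energyNorm (a - s) := norm_nonneg _
    rw [lt_div_iff₀ (by positivity)] at h1
    rw [h2]
    nlinarith [abs_nonneg c]

/-- `𝒱_q = ℙ_q(Ω) ∩ H¹₀(Ω)`: the elements of `H¹₀(Ω)` given by a polynomial in two variables of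
total degree at most `q`. -/
def V (q : ℕ) : Submodule ℝ H10 where
  carrier := {u | ∃ p : MvPolynomial (Fin 2) ℝ, p.totalDegree ≤ q ∧
    Represents (toL2 u) (fun x => MvPolynomial.eval ![x.1, x.2] p)}
  zero_mem' := ⟨0, by simp, by simpa using represents_zero⟩
  add_mem' := by
    rintro u v ⟨f, hf, hu⟩ ⟨g, hg, hv⟩
    exact ⟨f + g, (MvPolynomial.totalDegree_add f g).trans (max_le hf hg),
      by simpa using hu.add hv⟩
  smul_mem' := by
    rintro c u ⟨f, hf, hu⟩
    exact ⟨c • f, (MvPolynomial.totalDegree_smul_le c f).trans hf,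
      by simpa [MvPolynomial.smul_eval] using hu.smul c⟩

/-- The Legendre polynomial `L_k`, normalized by `L_k(1) = 1`, through Rodrigues' formula
`L_k = 1 / (2 ^ k k!) (d/dx)^k (x² - 1)^k`. -/
def legendre (k : ℕ) : Polynomial ℝ :=
  Polynomial.C (1 / (2 ^ k * (k.factorial : ℝ))) *
    Polynomial.derivative^[k] ((Polynomial.X ^ 2 - 1) ^ k)

/-- The orthonormal Babuška–Shen basis of `H¹₀(-1,1)`,
`φ_k(x) = √(k - 1/2) ∫ₓ¹ L_{k-1}(s) ds`; it is used for `k ≥ 2` only. -/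
def bs (k : ℕ) (x : ℝ) : ℝ :=
  Real.sqrt ((k : ℝ) - 1 / 2) * ∫ s in x..1, (legendre (k - 1)).eval s

/-- The tensorized Babuška–Shen function `Φ_m(x) = φ_{m₁}(x₁) φ_{m₂}(x₂)`. -/
def Phi (m : ℕ × ℕ) (x : ℝ × ℝ) : ℝ := bs m.1 x.1 * bs m.2 x.2

/-- `𝒱_q^c`: the closure in `H¹₀(Ω)` of the span of the functions `Φ_m` with `m₁, m₂ ≥ 2` and
`|m| = m₁ + m₂ > q`. -/
def Vc (q : ℕ) : Submodule ℝ H10 :=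
  energyClosure (Submodule.span ℝ
    {u : H10 | ∃ m : ℕ × ℕ, 2 ≤ m.1 ∧ 2 ≤ m.2 ∧ q < m.1 + m.2 ∧ Represents (toL2 u) (Phi m)})

end BabuskaShen

end

/-!
The functions `Φ_m` are positive multiples of `e_i ⊗ e_j`, `m = (i + 2, j + 2)`, where
`e_i = ∫ₓ¹ L_{i+1} = (L_i - L_{i+2}) / (2i + 3)` (`primLeg`). As `∫ e_i L_{j+1}' = 0` for `i ≠ j`,
the coefficient of `e_i ⊗ e_j` is a multiple of the `L²(Ω)` inner product with
`L_{i+1}' ⊗ L_{j+1}'`, which makes sense for every `v ∈ H¹₀(Ω)` (`coef`). Hence truncation to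
`i + j ≤ N = q - 4` is a linear operator `proj N` on `H¹₀(Ω)`, and the theorem follows from three
facts, the constant being `3`.

* The energy norm of `proj N` is at most `2q` (`energyNorm_proj_le`). Integrating by parts once, the
  coefficients of `v` are read off from `∂₁v` by means of `L_{i+1} ⊗ L_{j+1}'`, and `∂₁` of
  `e_i ⊗ e_j` is `-L_{i+1} ⊗ e_j`. For fixed `i` the recurrence `(2k+3) L_{k+1} = L_{k+2}' - L_k'`
  makes the truncated sum over `j < n` telescope to a Legendre partial sum and two rank one terms
  `½ ⟨·, L_n'⟩ L_{n+1}` and `½ ⟨·, L_{n-1}'⟩ L_n` (`sum_inner_smul_primLeg`). Since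
  `‖L_n'‖² = n (n + 1)` and `‖L_n‖² = 2 / (2n + 1)`, Bessel's inequality bounds all three sums
  (`norm_truncation_le`). The derivative `∂₂` is symmetric.
* `proj N` is the identity on `𝒱_q` and maps into it. If `v ∈ H¹₀(Ω)` is a polynomial, testing the
  integration by parts formula with `L_n ⊗ b`, `n → ∞`, shows that its traces vanish
  (`sum_eval_smul_eq_zero`), so that `v` is a combination of `e_i ⊗ e_j` of no larger degree
  (`V_le_basisSpan`).
* `proj N` vanishes on `𝒱_q^c`, by continuity, and `v - proj N v ∈ 𝒱_q^c`, by density of the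
  combinations of all `e_i ⊗ e_j` (`exists_mem_span_basisElem_near`). For a test function `f`,
  the function `∂₁∂₂f` has mean zero in each variable, so it is approximated in `L²(Ω)` by
  combinations of the `L_{i+1} ⊗ L_{j+1}`, and Poincaré's inequality passes from mixed derivatives
  to gradients.
-/

noncomputable section

namespace BabuskaShen

open Polynomial Filter Topology

/-! ### Legendre polynomials and their primitives -/

/-- The integral over `(-1, 1)`, as a linear functional on polynomials. -/
def integ : ℝ[X] →ₗ[ℝ] ℝ where
  toFun p := ∫ x in (-1 : ℝ)..1, p.eval x
  map_add' p q := by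
    simp only [eval_add]
    exact intervalIntegral.integral_add (p.continuous.intervalIntegrable _ _)
      (q.continuous.intervalIntegrable _ _)
  map_smul' c p := by simp

lemma integ_apply (p : ℝ[X]) : integ p = ∫ x in (-1 : ℝ)..1, p.eval x := rfl

lemma integ_derivative (p : ℝ[X]) : integ (derivative p) = p.eval 1 - p.eval (-1) :=
  intervalIntegral.integral_eq_sub_of_hasDerivAt (fun x _ => p.hasDerivAt x)
    ((derivative p).continuous.intervalIntegrable _ _)

lemma integ_derivative_mul (p q : ℝ[X]) :
    integ (derivative p * q) =
      p.eval 1 * q.eval 1 - p.eval (-1) * q.eval (-1) - integ (p * derivative q) := by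
  have h := integ_derivative (p * q)
  rw [derivative_mul, map_add, eval_mul, eval_mul] at h
  linarith

lemma eq_zero_of_integ_mul_self_eq_zero {p : ℝ[X]} (h : integ (p * p) = 0) : p = 0 := by
  have hc : ContinuousOn (fun x => (p * p).eval x) (Icc (-1) 1) := (p * p).continuous.continuousOn
  have h0 : ∀ x ∈ Icc (-1 : ℝ) 1, (p * p).eval x = 0 := by
    by_contra! hne
    obtain ⟨x, hx, hxne⟩ := hne
    have hpos : 0 < ∫ x in (-1 : ℝ)..1, (p * p).eval x :=
      intervalIntegral.integral_pos (by norm_num) hc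
        (fun x _ => by rw [eval_mul]; exact mul_self_nonneg _)
        ⟨x, hx, lt_of_le_of_ne (by rw [eval_mul]; exact mul_self_nonneg _) hxne.symm⟩
    exact hpos.ne' h
  refine eq_zero_of_infinite_isRoot p ((Icc_infinite (show (-1 : ℝ) < 1 by norm_num)).mono ?_)
  intro x hx
  simpa using h0 x hx

/-- Integrating by parts `k` times: there are no boundary terms, as `(X² - 1)ᵏ` vanishes to order
`k` at both end points. -/
lemma integ_iterate_derivative_mul (n k : ℕ) (hk : k ≤ n) (a : ℝ[X]) :
    integ (derivative^[k] ((X ^ 2 - 1) ^ n) * a) =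
      (-1) ^ k * integ ((X ^ 2 - 1) ^ n * derivative^[k] a) := by
  induction k generalizing a with
  | zero => simp
  | succ k ih =>
    obtain ⟨r, hr⟩ := pow_sub_dvd_iterate_derivative_pow (X ^ 2 - 1 : ℝ[X]) n k
    have h0 : ∀ t : ℝ, t ^ 2 = 1 → (derivative^[k] ((X ^ 2 - 1 : ℝ[X]) ^ n)).eval t = 0 := by
      intro t ht
      rw [hr]
      simp [ht, zero_pow (show n - k ≠ 0 by omega)]
    rw [Function.iterate_succ_apply', integ_derivative_mul, h0 1 (by norm_num),
      h0 (-1) (by norm_num), ih (by omega), Function.iterate_succ_apply]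
    ring

lemma integ_legendre_mul_of_natDegree_lt {k : ℕ} {a : ℝ[X]} (ha : a.natDegree < k) :
    integ (legendre k * a) = 0 := by
  rw [legendre, mul_assoc, ← smul_eq_C_mul, map_smul, integ_iterate_derivative_mul k k le_rfl,
    iterate_derivative_eq_zero ha]
  simp

lemma eval_iterate_derivative_X_sub_C_pow_mul (k : ℕ) (t : ℝ) (g : ℝ[X]) :
    (derivative^[k] ((X - C t) ^ k * g)).eval t = k.factorial * g.eval t := by
  have h := aeval_iterate_derivative_self ((X - C t) ^ k * g) k t (p' := g) (by simp)
  simpa [nsmul_eq_mul] using h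

lemma legendre_eval_one (k : ℕ) : (legendre k).eval 1 = 1 := by
  have h := eval_iterate_derivative_X_sub_C_pow_mul k 1 ((X + 1) ^ k)
  rw [← mul_pow, show (X - C 1 : ℝ[X]) * (X + 1) = X ^ 2 - 1 by simp; ring] at h
  rw [legendre, eval_mul, h]
  have := k.factorial_ne_zero
  simp
  norm_num
  field_simp

lemma legendre_eval_neg_one (k : ℕ) : (legendre k).eval (-1) = (-1) ^ k := by
  have h := eval_iterate_derivative_X_sub_C_pow_mul k (-1) ((X - 1) ^ k)
  rw [← mul_pow, show (X - C (-1) : ℝ[X]) * (X - 1) = X ^ 2 - 1 by simp; ring] at h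
  rw [legendre, eval_mul, h]
  have := k.factorial_ne_zero
  simp
  rw [show (-1 - 1 : ℝ) = (-1) * 2 by norm_num, mul_pow]
  field_simp

lemma legendre_zero : legendre 0 = 1 := by simp [legendre]

lemma legendre_one : legendre 1 = X := by
  simp only [legendre, pow_one, Function.iterate_one, derivative_sub, derivative_X_pow,
    derivative_one, sub_zero, Nat.factorial_one, ← mul_assoc, ← C_mul]
  norm_num

/-- The recurrence `(2k+3) L_{k+1} = L_{k+2}' - L_k'`, read off from
`D² u^{n+2} = 2(n+2)(2n+3) u^{n+1} + 4(n+2)(n+1) uⁿ` for `u = X² - 1`. -/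
lemma derivative_legendre_add_two (k : ℕ) :
    derivative (legendre (k + 2)) =
      (2 * (k : ℝ) + 3) • legendre (k + 1) + derivative (legendre k) := by
  have h2 : derivative (derivative ((X ^ 2 - 1 : ℝ[X]) ^ (k + 2))) =
      (2 * ((k : ℝ) + 2) * (2 * k + 3)) • (X ^ 2 - 1) ^ (k + 1) +
        (4 * ((k : ℝ) + 2) * (k + 1)) • (X ^ 2 - 1) ^ k := by
    simp only [derivative_pow, derivative_mul, derivative_sub, derivative_X, derivative_one,
      smul_eq_C_mul, map_mul, map_add, map_natCast, map_ofNat, derivative_natCast, derivative_zero]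
    push_cast
    simp only [map_one]
    ring
  have key : derivative (derivative^[k + 2] ((X ^ 2 - 1 : ℝ[X]) ^ (k + 2))) =
      (2 * ((k : ℝ) + 2) * (2 * k + 3)) • derivative^[k + 1] ((X ^ 2 - 1) ^ (k + 1)) +
        (4 * ((k : ℝ) + 2) * (k + 1)) • derivative (derivative^[k] ((X ^ 2 - 1) ^ k)) := by
    rw [← Function.iterate_succ_apply' derivative, ← Function.iterate_succ_apply' derivative,
      Function.iterate_succ_apply, Function.iterate_succ_apply, h2, iterate_map_add,
      iterate_derivative_smul, iterate_derivative_smul]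
  have hf : (k.factorial : ℝ) ≠ 0 := by exact_mod_cast k.factorial_ne_zero
  simp only [legendre, ← smul_eq_C_mul, derivative_smul]
  rw [key, smul_add, smul_smul, smul_smul, smul_smul, Nat.factorial_succ (k + 1),
    Nat.factorial_succ k]
  push_cast
  congr 2 <;> field_simp <;> ring

lemma natDegree_legendre_le (k : ℕ) : (legendre k).natDegree ≤ k := by
  refine (natDegree_C_mul_le _ _).trans ((natDegree_iterate_derivative _ _).trans ?_)
  have : ((X ^ 2 - 1 : ℝ[X]) ^ k).natDegree ≤ k * 2 :=
    natDegree_pow_le_of_le k (by compute_degree)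
  omega

/-- The squared norm of `L_k` in `L²(-1, 1)`. -/
lemma integ_legendre_mul_self (k : ℕ) :
    integ (legendre k * legendre k) = 2 / (2 * (k : ℝ) + 1) := by
  rcases k with _ | k
  · rw [legendre_zero, integ_apply]; norm_num
  -- the recurrence turns `(2k+3) L_{k+1}²` into `L_{k+2}' L_{k+1}` up to orthogonal terms
  have h1 : integ (legendre (k + 1) * derivative (legendre k)) = 0 :=
    integ_legendre_mul_of_natDegree_lt
      (lt_of_le_of_lt ((natDegree_derivative_le _).trans (Nat.sub_le _ _))
        (Nat.lt_succ_of_le (natDegree_legendre_le k)))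
  have h2 : integ (legendre (k + 2) * derivative (legendre (k + 1))) = 0 :=
    integ_legendre_mul_of_natDegree_lt
      (lt_of_le_of_lt ((natDegree_derivative_le _).trans (Nat.sub_le _ _))
        (Nat.lt_succ_of_le (natDegree_legendre_le (k + 1))))
  have h3 := integ_derivative_mul (legendre (k + 2)) (legendre (k + 1))
  rw [derivative_legendre_add_two, add_mul, map_add, smul_mul_assoc, map_smul,
    mul_comm (derivative (legendre k)), h1, h2] at h3
  simp only [legendre_eval_one, legendre_eval_neg_one, smul_eq_mul, ← pow_add] at h3
  rw [show k + 2 + (k + 1) = 2 * (k + 1) + 1 by ring, pow_succ, pow_mul] at h3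
  rw [eq_div_iff (by positivity)]
  push_cast
  norm_num at h3
  linarith

lemma natDegree_legendre (k : ℕ) : (legendre k).natDegree = k := by
  refine le_antisymm (natDegree_legendre_le k) (le_of_not_gt fun h => ?_)
  -- otherwise `L_k` would be orthogonal to itself
  have h0 := integ_legendre_mul_of_natDegree_lt h
  rw [integ_legendre_mul_self] at h0
  have : (0 : ℝ) < 2 / (2 * (k : ℝ) + 1) := by positivity
  exact this.ne' h0

lemma legendre_ne_zero (k : ℕ) : legendre k ≠ 0 := fun h => by
  simpa [h] using legendre_eval_one k

lemma integ_legendre_mul_legendre {j k : ℕ} (h : j ≠ k) :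
    integ (legendre j * legendre k) = 0 := by
  rcases lt_or_gt_of_ne h with h | h
  · rw [mul_comm]
    exact integ_legendre_mul_of_natDegree_lt (by rwa [natDegree_legendre])
  · exact integ_legendre_mul_of_natDegree_lt (by rwa [natDegree_legendre])

/-- The squared norm of `L_k'` in `L²(-1, 1)`. -/
lemma integ_derivative_legendre_mul_self (k : ℕ) :
    integ (derivative (legendre k) * derivative (legendre k)) = (k : ℝ) * (k + 1) := by
  induction k using Nat.twoStepInduction with
  | zero => simp [legendre_zero]
  | one => rw [legendre_one, integ_apply]; norm_num
  | more k ih _ =>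
    have h1 : integ (legendre (k + 1) * derivative (legendre k)) = 0 :=
      integ_legendre_mul_of_natDegree_lt
        (lt_of_le_of_lt ((natDegree_derivative_le _).trans (Nat.sub_le _ _))
          (Nat.lt_succ_of_le (natDegree_legendre_le k)))
    rw [derivative_legendre_add_two, add_mul, mul_add, mul_add, map_add, map_add, map_add, ih]
    simp only [smul_mul_assoc, mul_smul_comm, map_smul, h1, mul_comm (derivative (legendre k)),
      integ_legendre_mul_self, smul_eq_mul]
    push_cast
    field_simp
    ring

/-- The Legendre polynomials form a polynomial sequence, one for each degree. -/
def legendreSequence : Polynomial.Sequence ℝ where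
  elems' := legendre
  degree_eq' i := by rw [degree_eq_natDegree (legendre_ne_zero i), natDegree_legendre]

lemma mem_span_legendre {d : ℕ} {a : ℝ[X]} (ha : a.natDegree ≤ d) :
    a ∈ Submodule.span ℝ (legendre '' Iic d) := by
  have h := legendreSequence.span_degreeLE (m := d)
    (fun i _ => (leadingCoeff_ne_zero.2 (legendreSequence.ne_zero i)).isUnit)
  have h2 : a ∈ degreeLE ℝ d := mem_degreeLE.2 (natDegree_le_iff_degree_le.1 ha)
  rw [← h] at h2
  exact h2

lemma span_range_legendre : Submodule.span ℝ (range legendre) = ⊤ :=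
  legendreSequence.span
    (fun i => (leadingCoeff_ne_zero.2 (legendreSequence.ne_zero i)).isUnit)

/-- The polynomial `e_i = (L_i - L_{i+2}) / (2i+3)`, which is `∫ₓ¹ L_{i+1}`: a positive multiple
of the Babuška–Shen function `φ_{i+2}`. -/
def primLeg (i : ℕ) : ℝ[X] := (1 / (2 * (i : ℝ) + 3)) • (legendre i - legendre (i + 2))

lemma derivative_primLeg (i : ℕ) : derivative (primLeg i) = -legendre (i + 1) := by
  have : (2 * (i : ℝ) + 3) ≠ 0 := by positivity
  rw [primLeg, derivative_smul, derivative_sub, derivative_legendre_add_two, sub_add_cancel_right,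
    smul_neg, smul_smul, one_div_mul_cancel this, one_smul]

lemma primLeg_eval_one (i : ℕ) : (primLeg i).eval 1 = 0 := by
  simp [primLeg, legendre_eval_one]

lemma primLeg_eval_neg_one (i : ℕ) : (primLeg i).eval (-1) = 0 := by
  simp [primLeg, legendre_eval_neg_one, pow_add]

lemma natDegree_primLeg_le (i : ℕ) : (primLeg i).natDegree ≤ i + 2 := by
  refine (natDegree_smul_le _ _).trans ((natDegree_sub_le _ _).trans (max_le ?_ ?_))
  · rw [natDegree_legendre]; omega
  · rw [natDegree_legendre]

lemma integral_legendre_eq_primLeg (i : ℕ) (x : ℝ) :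
    ∫ s in x..1, (legendre (i + 1)).eval s = (primLeg i).eval x := by
  have h := intervalIntegral.integral_eq_sub_of_hasDerivAt (a := x) (b := 1)
    (fun x _ => (primLeg i).hasDerivAt x)
    ((derivative (primLeg i)).continuous.intervalIntegrable _ _)
  rw [derivative_primLeg, primLeg_eval_one] at h
  simp only [eval_neg, intervalIntegral.integral_neg] at h
  linarith

lemma bs_eq (i : ℕ) (x : ℝ) : bs (i + 2) x = Real.sqrt ((i : ℝ) + 3 / 2) * (primLeg i).eval x := by
  rw [bs, show i + 2 - 1 = i + 1 from rfl, integral_legendre_eq_primLeg]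
  push_cast
  ring_nf

/-- Duality between the functions `e_i` and the polynomials `L_{j+1}'`. -/
lemma integ_primLeg_mul_derivative (i j : ℕ) :
    integ (primLeg i * derivative (legendre (j + 1))) =
      if i = j then 1 / ((i : ℝ) + 3 / 2) else 0 := by
  have h := integ_derivative_mul (legendre (j + 1)) (primLeg i)
  rw [primLeg_eval_one, primLeg_eval_neg_one, derivative_primLeg] at h
  rw [mul_comm, h]
  simp only [mul_neg, map_neg]
  split_ifs with hij
  · subst hij
    rw [integ_legendre_mul_self]
    push_cast
    field_simp
    ring
  · rw [integ_legendre_mul_legendre (by omega)]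
    simp

/-- Subtraction of the linear interpolant at the end points `±1`. -/
def subInterp : ℝ[X] →ₗ[ℝ] ℝ[X] where
  toFun a := a - ((a.eval 1 + a.eval (-1)) / 2) • 1 - ((a.eval 1 - a.eval (-1)) / 2) • X
  map_add' a b := by simp only [eval_add]; module
  map_smul' c a := by simp only [eval_smul, smul_eq_mul, RingHom.id_apply]; module

lemma subInterp_apply (a : ℝ[X]) : subInterp a =
    a - ((a.eval 1 + a.eval (-1)) / 2) • 1 - ((a.eval 1 - a.eval (-1)) / 2) • X := rfl

lemma subInterp_legendre_mem (i : ℕ) :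
    subInterp (legendre i) ∈ Submodule.span ℝ (primLeg '' {j | j + 2 ≤ i}) := by
  induction i using Nat.twoStepInduction with
  | zero => simp [subInterp_apply, legendre_zero]
  | one => simp [subInterp_apply, legendre_one]
  | more i ih _ =>
    have h : legendre (i + 2) = legendre i - (2 * (i : ℝ) + 3) • primLeg i := by
      have : (2 * (i : ℝ) + 3) ≠ 0 := by positivity
      rw [primLeg, smul_smul, mul_one_div_cancel this, one_smul, sub_sub_cancel]
    have h2 : subInterp (primLeg i) = primLeg i := by
      simp [subInterp_apply, primLeg_eval_one, primLeg_eval_neg_one]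
    rw [h, map_sub, map_smul, h2]
    refine Submodule.sub_mem _ (Submodule.span_mono (image_mono ?_) ih)
      (Submodule.smul_mem _ _ (Submodule.subset_span ⟨i, le_refl (i + 2), rfl⟩))
    intro j hj
    exact le_trans hj (Nat.le_add_right i 2)

lemma subInterp_mem {d : ℕ} {a : ℝ[X]} (ha : a.natDegree ≤ d) :
    subInterp a ∈ Submodule.span ℝ (primLeg '' {j | j + 2 ≤ d}) := by
  have h := Submodule.mem_map_of_mem (f := subInterp) (mem_span_legendre ha)
  rw [Submodule.map_span] at h
  refine Submodule.span_le.2 ?_ h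
  rintro _ ⟨_, ⟨i, hi, rfl⟩, rfl⟩
  refine Submodule.span_mono (image_mono ?_) (subInterp_legendre_mem i)
  intro j hj
  exact le_trans (show j + 2 ≤ i from hj) (mem_Iic.1 hi)

lemma integ_mul_derivative_legendre {n : ℕ} {a : ℝ[X]} (ha : a.natDegree < n) :
    integ (a * derivative (legendre n)) = a.eval 1 - (-1) ^ n * a.eval (-1) := by
  have h := integ_derivative_mul (legendre n) a
  rw [integ_legendre_mul_of_natDegree_lt
    (lt_of_le_of_lt ((natDegree_derivative_le a).trans (Nat.sub_le _ _)) ha),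
    legendre_eval_one, legendre_eval_neg_one] at h
  rw [mul_comm, h]
  ring

/-! ### The truncation in Legendre coordinates -/

section Operators

variable {E : Type*} [NormedAddCommGroup E] [InnerProductSpace ℝ E]

lemma norm_sq_sum_of_orthogonal {ι : Type*} (s : Finset ι) (r : ι → E)
    (hr : ∀ i ∈ s, ∀ j ∈ s, i ≠ j → inner ℝ (r i) (r j) = 0) (a : ι → ℝ) :
    ‖∑ i ∈ s, a i • r i‖ ^ 2 = ∑ i ∈ s, a i ^ 2 * ‖r i‖ ^ 2 := by
  rw [← real_inner_self_eq_norm_sq, sum_inner]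
  refine Finset.sum_congr rfl fun i hi => ?_
  rw [inner_sum, Finset.sum_eq_single_of_mem i hi]
  · rw [real_inner_smul_left, real_inner_smul_right, real_inner_self_eq_norm_sq]; ring
  · intro j hj hji
    rw [real_inner_smul_left, real_inner_smul_right, hr i hi j hj hji.symm]; ring

/-- Bessel's inequality for an orthogonal family, whose members may vanish. -/
lemma sum_inner_sq_div_le {ι : Type*} (s : Finset ι) (p : ι → E)
    (hp : ∀ i ∈ s, ∀ j ∈ s, i ≠ j → inner ℝ (p i) (p j) = 0) (A : E) :
    ∑ i ∈ s, inner ℝ (p i) A ^ 2 / ‖p i‖ ^ 2 ≤ ‖A‖ ^ 2 := by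
  set a : ι → ℝ := fun i => inner ℝ (p i) A / ‖p i‖ ^ 2 with ha
  have h1 := norm_sub_sq_real A (∑ i ∈ s, a i • p i)
  have h2 : inner ℝ A (∑ i ∈ s, a i • p i) = ∑ i ∈ s, inner ℝ (p i) A ^ 2 / ‖p i‖ ^ 2 := by
    rw [inner_sum]
    refine Finset.sum_congr rfl fun i _ => ?_
    rw [real_inner_smul_right, real_inner_comm, ha]; ring
  have h3 : ‖∑ i ∈ s, a i • p i‖ ^ 2 = ∑ i ∈ s, inner ℝ (p i) A ^ 2 / ‖p i‖ ^ 2 := by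
    rw [norm_sq_sum_of_orthogonal s p hp]
    refine Finset.sum_congr rfl fun i _ => ?_
    rcases eq_or_ne (p i) 0 with h | h
    · simp [h]
    · have : ‖p i‖ ≠ 0 := norm_ne_zero_iff.2 h
      simp only [ha]; field_simp
  nlinarith [sq_nonneg ‖A - ∑ i ∈ s, a i • p i‖]

lemma norm_sum_inner_smul_le {ι : Type*} (s : Finset ι) (p r : ι → E)
    (hp : ∀ i ∈ s, ∀ j ∈ s, i ≠ j → inner ℝ (p i) (p j) = 0)
    (hr : ∀ i ∈ s, ∀ j ∈ s, i ≠ j → inner ℝ (r i) (r j) = 0) {K : ℝ} (hK : 0 ≤ K)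
    (h : ∀ i ∈ s, ‖p i‖ ^ 2 * ‖r i‖ ^ 2 ≤ K ^ 2) (A : E) :
    ‖∑ i ∈ s, inner ℝ (p i) A • r i‖ ≤ K * ‖A‖ := by
  refine le_of_sq_le_sq ?_ (by positivity)
  rw [norm_sq_sum_of_orthogonal s r hr, mul_pow]
  calc _ ≤ ∑ i ∈ s, K ^ 2 * (inner ℝ (p i) A ^ 2 / ‖p i‖ ^ 2) := by
        refine Finset.sum_le_sum fun i hi => ?_
        rcases eq_or_ne (p i) 0 with h0 | h0
        · simp [h0]
        · have : 0 < ‖p i‖ ^ 2 := by positivity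
          rw [← mul_div_assoc, le_div_iff₀ this]
          nlinarith [h i hi, sq_nonneg (inner ℝ (p i) A)]
    _ ≤ _ := by
        rw [← Finset.mul_sum]
        exact mul_le_mul_of_nonneg_left (sum_inner_sq_div_le s p hp A) (sq_nonneg K)

variable (T : ℝ[X] →ₗ[ℝ] ℝ[X] →ₗ[ℝ] E)

/-- The truncation to degrees below `n` in the second variable, summed by parts. Only the two
last terms are not orthogonal projections. For `n = 0` the truncated subtraction `n - 1` does no
harm, as `L_0' = 0`. -/
lemma sum_inner_smul_primLeg (A : E) (a : ℝ[X]) (n : ℕ) :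
    ∑ j ∈ Finset.range n,
        (((j : ℝ) + 3 / 2) * inner ℝ (T a (derivative (legendre (j + 1)))) A) • T a (primLeg j) =
      ∑ k ∈ Finset.range n, (((k : ℝ) + 1 / 2) * inner ℝ (T a (legendre k)) A) • T a (legendre k) -
        (1 / 2 * inner ℝ (T a (derivative (legendre n))) A) • T a (legendre (n + 1)) -
        (1 / 2 * inner ℝ (T a (derivative (legendre (n - 1)))) A) • T a (legendre n) := by
  have he : ∀ j : ℕ, ((j : ℝ) + 3 / 2) • T a (primLeg j) =
      (1 / 2 : ℝ) • (T a (legendre j) - T a (legendre (j + 2))) := by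
    intro j
    rw [primLeg, map_smul, smul_smul, map_sub]
    congr 1
    field_simp
  induction n with
  | zero => simp [legendre_zero]
  | succ n ih =>
    rw [Finset.sum_range_succ, Finset.sum_range_succ, ih, mul_comm ((n : ℝ) + 3 / 2),
      mul_smul _ ((n : ℝ) + 3 / 2), he]
    rcases n with _ | n
    · simp only [legendre_zero, legendre_one, derivative_X, derivative_one, map_zero,
        inner_zero_left, Nat.cast_zero, Nat.sub_self, Nat.zero_sub, zero_add]
      module
    · have h3 : ((n + 1 : ℕ) : ℝ) + 1 / 2 = (2 * (n : ℝ) + 3) / 2 := by push_cast; ring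
      have h4 : inner ℝ (T a (derivative (legendre (n + 1 + 1)))) A =
          (2 * (n : ℝ) + 3) * inner ℝ (T a (legendre (n + 1))) A +
            inner ℝ (T a (derivative (legendre n))) A := by
        rw [derivative_legendre_add_two, map_add, map_smul, inner_add_left, real_inner_smul_left]
      rw [h3, h4]
      simp only [Nat.add_sub_cancel]
      module

variable {T}

lemma norm_sq_tensor (hT : ∀ a b c d, inner ℝ (T a b) (T c d) = integ (a * c) * integ (b * d))
    (a b : ℝ[X]) : ‖T a b‖ ^ 2 = integ (a * a) * integ (b * b) := by
  rw [← real_inner_self_eq_norm_sq, hT]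

/-- The operator that takes `A = ∂₁v` to `∂₁` of the part of total degree at most `N + 4` of
`v` grows at most linearly in `N`. -/
lemma norm_truncation_le
    (hT : ∀ a b c d, inner ℝ (T a b) (T c d) = integ (a * c) * integ (b * d)) (A : E) (N : ℕ) :
    ‖∑ i ∈ Finset.range (N + 1), ∑ j ∈ Finset.range (N + 1 - i),
        (((i : ℝ) + 3 / 2) * ((j : ℝ) + 3 / 2) *
          inner ℝ (T (legendre (i + 1)) (derivative (legendre (j + 1)))) A) •
            T (legendre (i + 1)) (primLeg j)‖ ≤ 2 * ((N : ℝ) + 4) * ‖A‖ := by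
  set n : ℕ → ℕ := fun i => N + 1 - i with hn
  have hnN : ∀ i, (n i : ℝ) ≤ N + 1 := fun i => by
    exact_mod_cast Nat.sub_le _ _
  -- the Legendre partial sums and the two boundary terms of the summation by parts
  set S₁ := ∑ x ∈ (Finset.range (N + 1)).sigma fun i => Finset.range (n i),
    inner ℝ ((((x.1 : ℝ) + 3 / 2) * ((x.2 : ℝ) + 1 / 2)) • T (legendre (x.1 + 1)) (legendre x.2)) A •
      T (legendre (x.1 + 1)) (legendre x.2) with hS₁
  set S₂ := ∑ i ∈ Finset.range (N + 1),
    inner ℝ ((((i : ℝ) + 3 / 2) * (1 / 2)) • T (legendre (i + 1)) (derivative (legendre (n i)))) A •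
      T (legendre (i + 1)) (legendre (n i + 1)) with hS₂
  set S₃ := ∑ i ∈ Finset.range (N + 1),
    inner ℝ ((((i : ℝ) + 3 / 2) * (1 / 2)) •
      T (legendre (i + 1)) (derivative (legendre (n i - 1)))) A •
      T (legendre (i + 1)) (legendre (n i)) with hS₃
  have hL : ∀ i j : ℕ, i ≠ j → integ (legendre (i + 1) * legendre (j + 1)) = 0 := fun i j h =>
    integ_legendre_mul_legendre (by omega)
  have hsum : ∑ i ∈ Finset.range (N + 1), ∑ j ∈ Finset.range (N + 1 - i),
        (((i : ℝ) + 3 / 2) * ((j : ℝ) + 3 / 2) *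
          inner ℝ (T (legendre (i + 1)) (derivative (legendre (j + 1)))) A) •
            T (legendre (i + 1)) (primLeg j) = S₁ - S₂ - S₃ := by
    rw [hS₁, Finset.sum_sigma, hS₂, hS₃, ← Finset.sum_sub_distrib, ← Finset.sum_sub_distrib]
    refine Finset.sum_congr rfl fun i _ => ?_
    have h := congrArg (fun y => ((i : ℝ) + 3 / 2) • y)
      (sum_inner_smul_primLeg T A (legendre (i + 1)) (n i))
    simp only [smul_sub, Finset.smul_sum, smul_smul] at h
    simp only [real_inner_smul_left]
    simp only [mul_assoc] at h ⊢
    exact h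
  have hc : ∀ i : ℕ, integ (legendre (i + 1) * legendre (i + 1)) = 1 / ((i : ℝ) + 3 / 2) := by
    intro i
    rw [integ_legendre_mul_self]; push_cast; field_simp; ring
  have b₁ : ‖S₁‖ ≤ 1 * ‖A‖ := by
    have ho : ∀ x y : (_ : ℕ) × ℕ, x ≠ y →
        inner ℝ (T (legendre (x.1 + 1)) (legendre x.2))
          (T (legendre (y.1 + 1)) (legendre y.2)) = 0 := by
      rintro ⟨i, j⟩ ⟨k, l⟩ h
      rw [hT]
      by_cases hik : i = k
      · have hjl : j ≠ l := by rintro rfl; exact h (by rw [hik])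
        rw [integ_legendre_mul_legendre hjl, mul_zero]
      · rw [hL i k hik, zero_mul]
    refine norm_sum_inner_smul_le _ _ _ (fun x _ y _ h => ?_) (fun x _ y _ h => ho x y h)
      zero_le_one (fun x _ => ?_) A
    · rw [real_inner_smul_left, real_inner_smul_right, ho x y h]; ring
    · rw [norm_smul, mul_pow, norm_sq_tensor hT, hc, integ_legendre_mul_self, Real.norm_eq_abs,
        sq_abs]
      refine le_of_eq ?_
      field_simp
  have b₂ : ‖S₂‖ ≤ ((N : ℝ) + 2) * ‖A‖ := by
    refine norm_sum_inner_smul_le _ _ _ (fun i _ j _ h => ?_) (fun i _ j _ h => ?_)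
      (by positivity) (fun i _ => ?_) A
    · rw [real_inner_smul_left, real_inner_smul_right, hT, hL i j h]; ring
    · rw [hT, hL i j h, zero_mul]
    · rw [norm_smul, mul_pow, norm_sq_tensor hT, norm_sq_tensor hT, hc, integ_legendre_mul_self,
        integ_derivative_legendre_mul_self, Real.norm_eq_abs, sq_abs]
      have h0 : (0 : ℝ) ≤ n i := Nat.cast_nonneg _
      have : (((i : ℝ) + 3 / 2) * (1 / 2)) ^ 2 *
          (1 / ((i : ℝ) + 3 / 2) * ((n i : ℝ) * ((n i : ℝ) + 1))) *
          (1 / ((i : ℝ) + 3 / 2) * (2 / (2 * ((n i + 1 : ℕ) : ℝ) + 1))) =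
          (n i : ℝ) * ((n i : ℝ) + 1) / (2 * (2 * (n i : ℝ) + 3)) := by
        push_cast; field_simp; ring
      rw [this, div_le_iff₀ (by positivity)]
      nlinarith [hnN i]
  have b₃ : ‖S₃‖ ≤ ((N : ℝ) + 2) * ‖A‖ := by
    refine norm_sum_inner_smul_le _ _ _ (fun i _ j _ h => ?_) (fun i _ j _ h => ?_)
      (by positivity) (fun i _ => ?_) A
    · rw [real_inner_smul_left, real_inner_smul_right, hT, hL i j h]; ring
    · rw [hT, hL i j h, zero_mul]
    · rw [norm_smul, mul_pow, norm_sq_tensor hT, norm_sq_tensor hT, hc, integ_legendre_mul_self,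
        integ_derivative_legendre_mul_self, Real.norm_eq_abs, sq_abs]
      have h0 : (0 : ℝ) ≤ n i := Nat.cast_nonneg _
      have h1 : ((n i - 1 : ℕ) : ℝ) ≤ n i := by exact_mod_cast Nat.sub_le _ _
      have h2 : (0 : ℝ) ≤ ((n i - 1 : ℕ) : ℝ) := Nat.cast_nonneg _
      have : (((i : ℝ) + 3 / 2) * (1 / 2)) ^ 2 *
          (1 / ((i : ℝ) + 3 / 2) * (((n i - 1 : ℕ) : ℝ) * (((n i - 1 : ℕ) : ℝ) + 1))) *
          (1 / ((i : ℝ) + 3 / 2) * (2 / (2 * (n i : ℝ) + 1))) =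
          ((n i - 1 : ℕ) : ℝ) * (((n i - 1 : ℕ) : ℝ) + 1) / (2 * (2 * (n i : ℝ) + 1)) := by
        field_simp
      rw [this, div_le_iff₀ (by positivity)]
      nlinarith [hnN i, mul_le_mul h1 (add_le_add_left h1 1) (by positivity) h0]
  rw [hsum]
  calc ‖S₁ - S₂ - S₃‖ ≤ ‖S₁‖ + ‖S₂‖ + ‖S₃‖ :=
        (norm_sub_le _ _).trans (add_le_add_left (norm_sub_le _ _) _)
    _ ≤ 1 * ‖A‖ + ((N : ℝ) + 2) * ‖A‖ + ((N : ℝ) + 2) * ‖A‖ :=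
        add_le_add (add_le_add b₁ b₂) b₃
    _ ≤ _ := by nlinarith [norm_nonneg A]

end Operators

/-! ### Polynomials in `L²(Ω)` -/

/-- The measure of `L²(Ω)`. -/
abbrev volOmega : Measure (ℝ × ℝ) := (volume : Measure (ℝ × ℝ)).restrict Omega

lemma measurableSet_Omega : MeasurableSet Omega := measurableSet_Ioo.prod measurableSet_Ioo

lemma volume_Omega : volume Omega = 4 := by
  rw [Omega, Measure.volume_eq_prod, Measure.prod_prod, Real.volume_Ioo]
  rw [← ENNReal.ofReal_mul (by norm_num)]
  norm_num

instance : IsFiniteMeasure volOmega := ⟨by rw [Measure.restrict_apply_univ, volume_Omega]; simp⟩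

lemma exists_bound_on_Omega {f : ℝ × ℝ → ℝ} (hf : Continuous f) :
    ∃ c, ∀ x ∈ Omega, ‖f x‖ ≤ c := by
  obtain ⟨c, hc⟩ := (isCompact_Icc.prod isCompact_Icc :
    IsCompact (Icc (-1 : ℝ) 1 ×ˢ Icc (-1 : ℝ) 1)).exists_bound_of_continuousOn hf.continuousOn
  exact ⟨c, fun x hx => hc x (prod_mono Ioo_subset_Icc_self Ioo_subset_Icc_self hx)⟩

lemma memLp_of_continuous {f : ℝ × ℝ → ℝ} (hf : Continuous f) : MemLp f 2 volOmega := by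
  obtain ⟨c, hc⟩ := exists_bound_on_Omega hf
  exact MemLp.of_bound hf.aestronglyMeasurable c
    ((ae_restrict_iff' measurableSet_Omega).2 (Filter.Eventually.of_forall hc))

lemma integrableOn_of_continuous {f : ℝ × ℝ → ℝ} (hf : Continuous f) : IntegrableOn f Omega :=
  (memLp_of_continuous hf).integrable one_le_two

/-- The class in `L²(Ω)` of a continuous function on the plane. -/
def ofCont : C(ℝ × ℝ, ℝ) →ₗ[ℝ] L2 where
  toFun f := (memLp_of_continuous f.continuous).toLp f
  map_add' _ _ := rfl
  map_smul' _ _ := rfl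

lemma represents_ofCont (f : C(ℝ × ℝ, ℝ)) : Represents (ofCont f) f :=
  (memLp_of_continuous f.continuous).coeFn_toLp

lemma Represents.eq {u v : L2} {f : ℝ × ℝ → ℝ} (hu : Represents u f) (hv : Represents v f) :
    u = v := Lp.ext (hu.trans hv.symm)

lemma Represents.congr {u : L2} {f g : ℝ × ℝ → ℝ} (hu : Represents u f) (h : ∀ x, f x = g x) :
    Represents u g := (funext h : f = g) ▸ hu

lemma Represents.sum {ι : Type*} (s : Finset ι) (u : ι → L2) (f : ι → ℝ × ℝ → ℝ)
    (h : ∀ i ∈ s, Represents (u i) (f i)) :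
    Represents (∑ i ∈ s, u i) (fun x => ∑ i ∈ s, f i x) := by
  classical
  induction s using Finset.induction_on with
  | empty => simpa using represents_zero
  | insert i s hi ih =>
    simp only [Finset.sum_insert hi]
    exact (h i (Finset.mem_insert_self i s)).add
      (ih fun j hj => h j (Finset.mem_insert_of_mem hj))

lemma inner_ofCont_eq_integral (f : C(ℝ × ℝ, ℝ)) {u : L2} {g : ℝ × ℝ → ℝ} (hu : Represents u g) :
    inner ℝ (ofCont f) u = ∫ x in Omega, f x * g x := by
  rw [L2.inner_def]
  refine integral_congr_ae ?_
  filter_upwards [represents_ofCont f, hu] with x h1 h2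
  rw [h1, h2, real_inner_eq_re_inner, RCLike.inner_apply]
  simp [mul_comm]

lemma norm_sq_ofCont (f : C(ℝ × ℝ, ℝ)) : ‖ofCont f‖ ^ 2 = ∫ x in Omega, f x ^ 2 := by
  rw [← real_inner_self_eq_norm_sq, inner_ofCont_eq_integral f (represents_ofCont f)]
  simp only [pow_two]

lemma norm_ofCont_le (f : C(ℝ × ℝ, ℝ)) {c : ℝ} (hc : 0 ≤ c) (h : ∀ x ∈ Omega, |f x| ≤ c) :
    ‖ofCont f‖ ≤ 2 * c := by
  refine le_of_sq_le_sq ?_ (by positivity)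
  rw [norm_sq_ofCont]
  have h1 : ∫ x in Omega, f x ^ 2 ≤ ∫ _ in Omega, c ^ 2 := by
    refine setIntegral_mono_on (integrableOn_of_continuous (f.continuous.pow 2))
      (integrableOn_of_continuous continuous_const) measurableSet_Omega fun x hx => ?_
    exact sq_le_sq.2 ((h x hx).trans (le_abs_self c))
  refine h1.trans (le_of_eq ?_)
  rw [setIntegral_const, Measure.real, volume_Omega]
  norm_num
  ring

/-- The continuous function `(x, y) ↦ a(x) b(y)`. -/
def tensorFun (a b : ℝ[X]) : C(ℝ × ℝ, ℝ) where
  toFun x := a.eval x.1 * b.eval x.2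

@[simp] lemma tensorFun_apply (a b : ℝ[X]) (x : ℝ × ℝ) :
    tensorFun a b x = a.eval x.1 * b.eval x.2 := rfl

/-- The class in `L²(Ω)` of `(x, y) ↦ a(x) b(y)`, for polynomials `a` and `b`. -/
def tensor : ℝ[X] →ₗ[ℝ] ℝ[X] →ₗ[ℝ] L2 :=
  LinearMap.mk₂ ℝ (fun a b => ofCont (tensorFun a b))
    (fun a₁ a₂ b => by rw [← map_add]; congr 1; ext x; simp [add_mul])
    (fun c a b => by rw [← map_smul]; congr 1; ext x; simp [mul_assoc])
    (fun a b₁ b₂ => by rw [← map_add]; congr 1; ext x; simp [mul_add])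
    (fun c a b => by rw [← map_smul]; congr 1; ext x; simp [mul_left_comm])

lemma tensor_apply (a b : ℝ[X]) : tensor a b = ofCont (tensorFun a b) := rfl

lemma represents_tensor (a b : ℝ[X]) :
    Represents (tensor a b) (fun x => a.eval x.1 * b.eval x.2) := represents_ofCont _

lemma inner_tensor (a b c d : ℝ[X]) :
    inner ℝ (tensor a b) (tensor c d) = integ (a * c) * integ (b * d) := by
  have h : ∀ p : ℝ[X], integ p = ∫ x in Ioo (-1 : ℝ) 1, p.eval x := fun p => by
    rw [integ_apply, intervalIntegral.integral_of_le (by norm_num), integral_Ioc_eq_integral_Ioo]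
  rw [tensor_apply, inner_ofCont_eq_integral _ (represents_tensor c d), h, h, ← setIntegral_prod_mul]
  refine integral_congr_ae (Filter.Eventually.of_forall fun x => ?_)
  simp only [tensorFun_apply, eval_mul]
  ring

lemma represents_sum_tensor_of_mvPolynomial (P : MvPolynomial (Fin 2) ℝ) :
    Represents (∑ m ∈ P.support, P.coeff m • tensor (X ^ m 0) (X ^ m 1))
      (fun x => MvPolynomial.eval ![x.1, x.2] P) := by
  refine (Represents.sum P.support _ _ fun m _ =>
    (represents_tensor (X ^ m 0) (X ^ m 1)).smul (P.coeff m)).congr fun x => ?_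
  rw [MvPolynomial.eval_eq']
  simp [Fin.prod_univ_two]

lemma continuous_eval_mvPolynomial (P : MvPolynomial (Fin 2) ℝ) :
    Continuous fun x : ℝ × ℝ => MvPolynomial.eval ![x.1, x.2] P := by
  simp only [MvPolynomial.eval_eq', Fin.prod_univ_two]
  refine continuous_finsetSum _ fun m _ => ?_
  simp only [Matrix.cons_val_zero, Matrix.cons_val_one]
  fun_prop

/-- The Weierstrass approximation theorem on the closed square. -/
lemma exists_mvPolynomial_near (f : C(ℝ × ℝ, ℝ)) {ε : ℝ} (hε : 0 < ε) :
    ∃ P : MvPolynomial (Fin 2) ℝ, ∀ x ∈ Omega, |f x - MvPolynomial.eval ![x.1, x.2] P| < ε := by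
  set K : Set (ℝ × ℝ) := Icc (-1 : ℝ) 1 ×ˢ Icc (-1 : ℝ) 1 with hK
  have : CompactSpace K := isCompact_iff_compactSpace.1 (isCompact_Icc.prod isCompact_Icc)
  let c : Fin 2 → C(K, ℝ) := ![⟨fun x => x.1.1, by fun_prop⟩, ⟨fun x => x.1.2, by fun_prop⟩]
  let A : Subalgebra ℝ C(K, ℝ) := (MvPolynomial.aeval c).range
  have hA : A.SeparatesPoints := by
    intro x y hxy
    by_cases h1 : x.1.1 = y.1.1
    · have h2 : x.1.2 ≠ y.1.2 := fun h2 => hxy (Subtype.ext (Prod.ext h1 h2))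
      exact ⟨_, ⟨c 1, ⟨MvPolynomial.X 1, MvPolynomial.aeval_X c 1⟩, rfl⟩, h2⟩
    · exact ⟨_, ⟨c 0, ⟨MvPolynomial.X 0, MvPolynomial.aeval_X c 0⟩, rfl⟩, h1⟩
  obtain ⟨⟨g, P, rfl⟩, hg⟩ := ContinuousMap.exists_mem_subalgebra_near_continuousMap_of_separatesPoints
    A hA (f.restrict K) ε hε
  refine ⟨P, fun x hx => ?_⟩
  have hxK : x ∈ K := prod_mono Ioo_subset_Icc_self Ioo_subset_Icc_self hx
  have h1 := (ContinuousMap.norm_coe_le_norm _ (⟨x, hxK⟩ : K)).trans_lt hg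
  have h2 : (MvPolynomial.aeval c P) (⟨x, hxK⟩ : K) = MvPolynomial.eval ![x.1, x.2] P := by
    have h3 : (ContinuousMap.evalAlgHom ℝ ℝ (⟨x, hxK⟩ : K)).comp (MvPolynomial.aeval c) =
        MvPolynomial.aeval ![x.1, x.2] := by
      ext i
      fin_cases i <;> simp [c]
    have h4 := DFunLike.congr_fun h3 P
    simpa [MvPolynomial.coe_aeval_eq_eval] using h4
  rw [abs_sub_comm, ← Real.norm_eq_abs, ← h2]
  simpa using h1

/-- The span in `L²(Ω)` of the functions `L_i ⊗ L_j`; it consists of all polynomials. -/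
def legendreSpan : Submodule ℝ L2 :=
  Submodule.span ℝ (range fun m : ℕ × ℕ => tensor (legendre m.1) (legendre m.2))

lemma tensor_mem_legendreSpan (a b : ℝ[X]) : tensor a b ∈ legendreSpan := by
  have ha : a ∈ Submodule.span ℝ (range legendre) := span_range_legendre ▸ Submodule.mem_top
  have hb : b ∈ Submodule.span ℝ (range legendre) := span_range_legendre ▸ Submodule.mem_top
  have h := Submodule.apply_mem_map₂ tensor ha hb
  rw [Submodule.map₂_span_span] at h
  refine Submodule.span_mono ?_ h
  rintro _ ⟨_, ⟨i, rfl⟩, _, ⟨j, rfl⟩, rfl⟩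
  exact ⟨(i, j), rfl⟩

/-- Polynomials are dense in `L²(Ω)`. -/
lemma exists_mem_legendreSpan_norm_sub_lt (u : L2) {ε : ℝ} (hε : 0 < ε) :
    ∃ s ∈ legendreSpan, ‖u - s‖ < ε := by
  obtain ⟨g, -, hg, hgc, hgm⟩ := (Lp.memLp u).exists_hasCompactSupport_eLpNorm_sub_le
    (by simp) (ε := ENNReal.ofReal (ε / 3)) (by simpa using by positivity)
  obtain ⟨P, hP⟩ := exists_mvPolynomial_near ⟨g, hgc⟩ (show 0 < ε / 6 by positivity)
  refine ⟨∑ m ∈ P.support, P.coeff m • tensor (X ^ m 0) (X ^ m 1), Submodule.sum_mem _ fun m _ =>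
    Submodule.smul_mem _ _ (tensor_mem_legendreSpan _ _), ?_⟩
  rw [(represents_sum_tensor_of_mvPolynomial P).eq
    (represents_ofCont ⟨_, continuous_eval_mvPolynomial P⟩)]
  have h1 : ‖u - ofCont ⟨g, hgc⟩‖ ≤ ε / 3 := by
    rw [Lp.norm_def]
    refine ENNReal.toReal_le_of_le_ofReal (by positivity) (le_trans (le_of_eq ?_) hg)
    refine eLpNorm_congr_ae ?_
    filter_upwards [Lp.coeFn_sub u (ofCont ⟨g, hgc⟩), represents_ofCont ⟨g, hgc⟩] with x h1 h2
    rw [h1, Pi.sub_apply, Pi.sub_apply, h2]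
    rfl
  have h2 : ‖ofCont ⟨g, hgc⟩ - ofCont ⟨_, continuous_eval_mvPolynomial P⟩‖ ≤ 2 * (ε / 6) := by
    rw [← map_sub]
    exact norm_ofCont_le _ (by positivity) fun x hx => (hP x hx).le
  calc _ ≤ _ := norm_sub_le_norm_sub_add_norm_sub _ (ofCont ⟨g, hgc⟩) _
    _ < ε := by linarith

lemma eq_zero_of_inner_tensor_eq_zero {u : L2} (h : ∀ a b, inner ℝ (tensor a b) u = 0) :
    u = 0 := by
  have h1 : ∀ s ∈ legendreSpan, inner ℝ s u = 0 := by
    intro s hs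
    induction hs using Submodule.span_induction with
    | mem x hx => obtain ⟨m, rfl⟩ := hx; exact h _ _
    | zero => exact inner_zero_left _
    | add x y _ _ hx hy => rw [inner_add_left, hx, hy, add_zero]
    | smul c x _ hx => rw [real_inner_smul_left, hx, mul_zero]
  by_contra hu
  have hpos : 0 < ‖u‖ := norm_pos_iff.2 hu
  obtain ⟨s, hs, hsu⟩ := exists_mem_legendreSpan_norm_sub_lt u hpos
  have h2 := norm_sub_sq_real u s
  rw [real_inner_comm, h1 s hs] at h2
  nlinarith [norm_nonneg (u - s), sq_nonneg ‖s‖]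

/-! ### Integration by parts in `H¹₀(Ω)` -/

lemma IsTestFunction.eq_zero_of_notMem {f : ℝ × ℝ → ℝ} (hf : IsTestFunction f) {x : ℝ × ℝ}
    (hx : x ∉ Omega) : f x = 0 :=
  image_eq_zero_of_notMem_tsupport fun h => hx (hf.support h)

lemma IsTestFunction.fderiv_apply {f : ℝ × ℝ → ℝ} (hf : IsTestFunction f) (v : ℝ × ℝ) :
    IsTestFunction fun x => fderiv ℝ f x v where
  smooth := (hf.smooth.fderiv_right (by norm_cast)).clm_apply contDiff_const
  compact := hf.compact.fderiv_apply ℝ v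
  support := (tsupport_fderiv_apply_subset ℝ v).trans hf.support

/-- Multiplication by a smooth function and integration by parts: the boundary terms vanish. -/
lemma IsTestFunction.integral_mul_fderiv {f : ℝ × ℝ → ℝ} (hf : IsTestFunction f)
    {g : ℝ × ℝ → ℝ} (hg : ContDiff ℝ ∞ g) (v : ℝ × ℝ) :
    ∫ x in Omega, g x * fderiv ℝ f x v = -∫ x in Omega, fderiv ℝ g x v * f x := by
  have hfc := hf.smooth.continuous
  have hgc := hg.continuous
  have hf' := hf.fderiv_apply v
  have hg' : Continuous fun x => fderiv ℝ g x v :=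
    (hg.continuous_fderiv (by simp)).clm_apply continuous_const
  rw [setIntegral_eq_integral_of_forall_compl_eq_zero fun x hx => by
      rw [hf'.eq_zero_of_notMem hx, mul_zero],
    setIntegral_eq_integral_of_forall_compl_eq_zero fun x hx => by
      rw [hf.eq_zero_of_notMem hx, mul_zero]]
  exact integral_mul_fderiv_eq_neg_fderiv_mul_of_integrable
    ((hg'.mul hfc).integrable_of_hasCompactSupport hf.compact.mul_left)
    ((hgc.mul hf'.smooth.continuous).integrable_of_hasCompactSupport hf'.compact.mul_left)
    ((hgc.mul hfc).integrable_of_hasCompactSupport hf.compact.mul_left)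
    (fun x _ => hg.differentiable (by simp) x) (fun x _ => hf.smooth.differentiable (by simp) x)

lemma contDiff_tensorFun (a b : ℝ[X]) : ContDiff ℝ ∞ (tensorFun a b) :=
  ((Polynomial.contDiff_aeval a ∞).comp contDiff_fst).mul
    ((Polynomial.contDiff_aeval b ∞).comp contDiff_snd)

lemma hasFDerivAt_tensorFun (a b : ℝ[X]) (x : ℝ × ℝ) :
    HasFDerivAt (tensorFun a b)
      (a.eval x.1 • (derivative b).eval x.2 • ContinuousLinearMap.snd ℝ ℝ ℝ +
        b.eval x.2 • (derivative a).eval x.1 • ContinuousLinearMap.fst ℝ ℝ ℝ) x :=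
  ((a.hasDerivAt x.1).comp_hasFDerivAt x hasFDerivAt_fst).mul
    ((b.hasDerivAt x.2).comp_hasFDerivAt x hasFDerivAt_snd)

lemma fderiv_tensorFun_fst (a b : ℝ[X]) (x : ℝ × ℝ) :
    fderiv ℝ (tensorFun a b) x (1, 0) = tensorFun (derivative a) b x := by
  rw [(hasFDerivAt_tensorFun a b x).fderiv]; simp [mul_comm]

lemma fderiv_tensorFun_snd (a b : ℝ[X]) (x : ℝ × ℝ) :
    fderiv ℝ (tensorFun a b) x (0, 1) = tensorFun a (derivative b) x := by
  rw [(hasFDerivAt_tensorFun a b x).fderiv]; simp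

lemma inner_tensor_grad_of_mem_testTriples {w : L2 × L2 × L2} (hw : w ∈ testTriples)
    (a b : ℝ[X]) :
    inner ℝ (tensor a b) w.2.1 = -inner ℝ (tensor (derivative a) b) w.1 ∧
      inner ℝ (tensor a b) w.2.2 = -inner ℝ (tensor a (derivative b)) w.1 := by
  obtain ⟨f, hf, h0, h1, h2⟩ := hw
  constructor
  · rw [tensor_apply, tensor_apply, inner_ofCont_eq_integral _ h1, inner_ofCont_eq_integral _ h0,
      hf.integral_mul_fderiv (contDiff_tensorFun a b)]
    simp only [fderiv_tensorFun_fst]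
  · rw [tensor_apply, tensor_apply, inner_ofCont_eq_integral _ h2, inner_ofCont_eq_integral _ h0,
      hf.integral_mul_fderiv (contDiff_tensorFun a b)]
    simp only [fderiv_tensorFun_snd]

lemma inner_tensor_grad (u : H10) (a b : ℝ[X]) :
    inner ℝ (tensor a b) u.1.2.1 = -inner ℝ (tensor (derivative a) b) u.1.1 ∧
      inner ℝ (tensor a b) u.1.2.2 = -inner ℝ (tensor a (derivative b)) u.1.1 := by
  have hcl : IsClosed {w : L2 × L2 × L2 |
      inner ℝ (tensor a b) w.2.1 = -inner ℝ (tensor (derivative a) b) w.1 ∧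
      inner ℝ (tensor a b) w.2.2 = -inner ℝ (tensor a (derivative b)) w.1} :=
    (isClosed_eq (by fun_prop) (by fun_prop)).inter (isClosed_eq (by fun_prop) (by fun_prop))
  exact closure_minimal (fun w hw => inner_tensor_grad_of_mem_testTriples hw a b) hcl u.2

/-- The function determines its weak gradient. -/
lemma toL2_injective : Function.Injective toL2 := by
  rw [injective_iff_map_eq_zero]
  intro u hu
  have hu : u.1.1 = 0 := hu
  have h1 : u.1.2.1 = 0 := eq_zero_of_inner_tensor_eq_zero fun a b => by
    rw [(inner_tensor_grad u a b).1, hu, inner_zero_right, neg_zero]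
  have h2 : u.1.2.2 = 0 := eq_zero_of_inner_tensor_eq_zero fun a b => by
    rw [(inner_tensor_grad u a b).2, hu, inner_zero_right, neg_zero]
  exact Subtype.ext (Prod.ext hu (Prod.ext h1 h2))

lemma energyNorm_sq (u : H10) : energyNorm u ^ 2 = ‖u.1.2.1‖ ^ 2 + ‖u.1.2.2‖ ^ 2 :=
  WithLp.prod_norm_sq_eq_of_L2 (grad u)

/-! ### Polynomials vanishing on the boundary belong to `H¹₀(Ω)` -/

/-- A smooth function that vanishes for `t ≤ 1` and is the identity for `t ≥ 2`. -/
def cutId (t : ℝ) : ℝ := t * Real.smoothTransition (t - 1)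

lemma contDiff_cutId : ContDiff ℝ ∞ cutId :=
  contDiff_id.mul (Real.smoothTransition.contDiff.comp (contDiff_id.sub contDiff_const))

lemma cutId_of_le_one {t : ℝ} (ht : t ≤ 1) : cutId t = 0 := by
  rw [cutId, Real.smoothTransition.zero_of_nonpos (by linarith), mul_zero]

lemma cutId_of_two_le {t : ℝ} (ht : 2 ≤ t) : cutId t = t := by
  rw [cutId, Real.smoothTransition.one_of_one_le (by linarith), mul_one]

lemma abs_cutId_le (t : ℝ) : |cutId t| ≤ |t| := by
  rw [cutId, abs_mul, abs_of_nonneg (Real.smoothTransition.nonneg _)]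
  exact mul_le_of_le_one_right (abs_nonneg _) (Real.smoothTransition.le_one _)

lemma deriv_cutId_of_two_lt {t : ℝ} (ht : 2 < t) : deriv cutId t = 1 := by
  have : cutId =ᶠ[𝓝 t] id := by
    filter_upwards [lt_mem_nhds ht] with s hs using cutId_of_two_le hs.le
  rw [this.deriv_eq, deriv_id]

lemma exists_abs_deriv_cutId_le : ∃ c, 0 ≤ c ∧ ∀ t, |deriv cutId t| ≤ c := by
  obtain ⟨c, hc⟩ := (isCompact_Icc : IsCompact (Icc (1 : ℝ) 2)).exists_bound_of_continuousOn
    (contDiff_cutId.continuous_deriv (by simp)).continuousOn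
  refine ⟨max c 1, by positivity, fun t => ?_⟩
  rcases lt_or_ge t 1 with h | h
  · have : cutId =ᶠ[𝓝 t] fun _ => 0 := by
      filter_upwards [gt_mem_nhds h] with s hs using cutId_of_le_one hs.le
    rw [this.deriv_eq, deriv_const]
    simp
  rcases le_or_gt t 2 with h2 | h2
  · exact (hc t ⟨h, h2⟩).trans (le_max_left _ _)
  · rw [deriv_cutId_of_two_lt h2]
    simp

/-- The function `1 - x²`, flattened to zero near the end points of `(-1, 1)`. -/
def bubble (n : ℕ) (x : ℝ) : ℝ := cutId (((n : ℝ) + 1) * (1 - x ^ 2)) / ((n : ℝ) + 1)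

lemma contDiff_bubble (n : ℕ) : ContDiff ℝ ∞ (bubble n) :=
  (contDiff_cutId.comp (by fun_prop)).div_const _

lemma deriv_bubble (n : ℕ) (x : ℝ) :
    deriv (bubble n) x = deriv cutId (((n : ℝ) + 1) * (1 - x ^ 2)) * (-(2 * x)) := by
  have h1 : HasDerivAt (fun x : ℝ => ((n : ℝ) + 1) * (1 - x ^ 2)) (((n : ℝ) + 1) * (-(2 * x))) x := by
    simpa using ((hasDerivAt_pow 2 x).const_sub 1).const_mul ((n : ℝ) + 1)
  have h2 : HasDerivAt cutId (deriv cutId (((n : ℝ) + 1) * (1 - x ^ 2)))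
      (((n : ℝ) + 1) * (1 - x ^ 2)) :=
    (contDiff_cutId.differentiable (by simp) _).hasDerivAt
  have h3 := ((h2.comp x h1).div_const ((n : ℝ) + 1)).deriv
  have h4 : ((n : ℝ) + 1) ≠ 0 := by positivity
  refine Eq.trans h3 ?_
  field_simp

lemma bubble_support_subset (n : ℕ) :
    Function.support (bubble n) ⊆ {x | 1 ≤ ((n : ℝ) + 1) * (1 - x ^ 2)} := by
  intro x hx
  by_contra h
  exact hx (by rw [bubble, cutId_of_le_one (not_le.1 h).le, zero_div])

lemma eventually_two_lt_mul {x : ℝ} (hx : x ∈ Ioo (-1 : ℝ) 1) :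
    ∀ᶠ n : ℕ in atTop, 2 < ((n : ℝ) + 1) * (1 - x ^ 2) := by
  have h : 0 < 1 - x ^ 2 := by nlinarith [hx.1, hx.2]
  exact ((tendsto_natCast_atTop_atTop.atTop_add tendsto_const_nhds).atTop_mul_const
    h).eventually_gt_atTop 2

/-- A polynomial that vanishes at `±1` is the limit of test functions on `(-1, 1)`, boundedly and
pointwise, together with the derivatives. -/
lemma exists_testFunction_approx {p : ℝ[X]} (h1 : p.eval 1 = 0) (h2 : p.eval (-1) = 0) :
    ∃ ψ : ℕ → ℝ → ℝ, (∀ n, ContDiff ℝ ∞ (ψ n)) ∧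
      (∀ n, ∃ K : Set ℝ, IsCompact K ∧ K ⊆ Ioo (-1) 1 ∧ Function.support (ψ n) ⊆ K) ∧
      (∃ c : ℝ, ∀ n, ∀ x ∈ Ioo (-1 : ℝ) 1, |ψ n x| ≤ c ∧ |deriv (ψ n) x| ≤ c) ∧
      (∀ x ∈ Ioo (-1 : ℝ) 1, Tendsto (fun n => ψ n x) atTop (𝓝 (p.eval x))) ∧
      ∀ x ∈ Ioo (-1 : ℝ) 1,
        Tendsto (fun n => deriv (ψ n) x) atTop (𝓝 ((derivative p).eval x)) := by
  obtain ⟨a, rfl⟩ : ∃ a, p = (1 - X ^ 2) * a := by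
    have hd : (X - C 1) * (X - C (-1)) ∣ p :=
      (isCoprime_X_sub_C_of_isUnit_sub (by norm_num)).mul_dvd
        (dvd_iff_isRoot.2 h1) (dvd_iff_isRoot.2 h2)
    obtain ⟨a, rfl⟩ := hd
    exact ⟨-a, by simp; ring⟩
  have hder : ∀ n x, deriv (fun x => bubble n x * a.eval x) x =
      deriv (bubble n) x * a.eval x + bubble n x * (derivative a).eval x := fun n x =>
    (((contDiff_bubble n).differentiable (by simp) x).hasDerivAt.mul (a.hasDerivAt x)).deriv
  obtain ⟨c, hc0, hc⟩ := exists_abs_deriv_cutId_le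
  obtain ⟨d, hd⟩ := (isCompact_Icc : IsCompact (Icc (-1 : ℝ) 1)).exists_bound_of_continuousOn
    a.continuous.continuousOn
  obtain ⟨d', hd'⟩ := (isCompact_Icc : IsCompact (Icc (-1 : ℝ) 1)).exists_bound_of_continuousOn
    (derivative a).continuous.continuousOn
  have hb : ∀ n, ∀ x ∈ Ioo (-1 : ℝ) 1, |bubble n x| ≤ 1 := by
    intro n x hx
    have h4 : 0 < (n : ℝ) + 1 := by positivity
    rw [bubble, abs_div, abs_of_pos h4, div_le_one h4]
    refine (abs_cutId_le _).trans ?_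
    rw [abs_mul, abs_of_pos h4]
    refine mul_le_of_le_one_right h4.le (abs_le.2 ⟨?_, ?_⟩) <;> nlinarith [hx.1, hx.2]
  have hb' : ∀ n, ∀ x ∈ Ioo (-1 : ℝ) 1, |deriv (bubble n) x| ≤ c * 2 := by
    intro n x hx
    rw [deriv_bubble, abs_mul]
    refine mul_le_mul (hc _) (abs_le.2 ⟨?_, ?_⟩) (abs_nonneg _) hc0 <;> linarith [hx.1, hx.2]
  refine ⟨fun n x => bubble n x * a.eval x,
    fun n => (contDiff_bubble n).mul (Polynomial.contDiff_aeval a ∞), fun n => ?_,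
    ⟨max (1 * d) (c * 2 * d + 1 * d'), fun n x hx => ⟨?_, ?_⟩⟩, fun x hx => ?_, fun x hx => ?_⟩
  · refine ⟨{x | 1 ≤ ((n : ℝ) + 1) * (1 - x ^ 2)}, ?_, ?_,
      (Function.support_mul_subset_left _ _).trans (bubble_support_subset n)⟩
    · refine (isCompact_Icc : IsCompact (Icc (-1 : ℝ) 1)).of_isClosed_subset
        (isClosed_le continuous_const (by fun_prop)) fun x hx => ?_
      have h4 : 0 < (n : ℝ) + 1 := by positivity
      have h5 : 0 < 1 - x ^ 2 := pos_of_mul_pos_right (zero_lt_one.trans_le hx) h4.le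
      exact ⟨by nlinarith, by nlinarith⟩
    · intro x hx
      have h4 : 0 < (n : ℝ) + 1 := by positivity
      have h5 : 0 < 1 - x ^ 2 := pos_of_mul_pos_right (zero_lt_one.trans_le hx) h4.le
      exact ⟨by nlinarith, by nlinarith⟩
  · rw [abs_mul]
    exact (mul_le_mul (hb n x hx) (hd x (Ioo_subset_Icc_self hx)) (abs_nonneg _)
      zero_le_one).trans (le_max_left _ _)
  · rw [hder]
    refine (abs_add_le _ _).trans (le_trans ?_ (le_max_right _ _))
    rw [abs_mul, abs_mul]
    exact add_le_add
      (mul_le_mul (hb' n x hx) (hd x (Ioo_subset_Icc_self hx)) (abs_nonneg _) (by positivity))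
      (mul_le_mul (hb n x hx) (hd' x (Ioo_subset_Icc_self hx)) (abs_nonneg _) zero_le_one)
  · refine tendsto_const_nhds.congr' ?_
    filter_upwards [eventually_two_lt_mul hx] with n hn
    have h4 : (n : ℝ) + 1 ≠ 0 := by positivity
    rw [bubble, cutId_of_two_le hn.le, mul_div_cancel_left₀ _ h4]
    simp
  · refine tendsto_const_nhds.congr' ?_
    filter_upwards [eventually_two_lt_mul hx] with n hn
    have h4 : (n : ℝ) + 1 ≠ 0 := by positivity
    rw [hder, deriv_bubble, deriv_cutId_of_two_lt hn, bubble, cutId_of_two_le hn.le,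
      mul_div_cancel_left₀ _ h4]
    simp [one_add_one_eq_two]

lemma isTestFunction_mul {ψ η : ℝ → ℝ} (hψ : ContDiff ℝ ∞ ψ) (hη : ContDiff ℝ ∞ η)
    (hψK : ∃ K : Set ℝ, IsCompact K ∧ K ⊆ Ioo (-1) 1 ∧ Function.support ψ ⊆ K)
    (hηK : ∃ K : Set ℝ, IsCompact K ∧ K ⊆ Ioo (-1) 1 ∧ Function.support η ⊆ K) :
    IsTestFunction fun x => ψ x.1 * η x.2 := by
  obtain ⟨K, hK, hKI, hψK⟩ := hψK
  obtain ⟨K', hK', hKI', hηK⟩ := hηK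
  have hs : Function.support (fun x : ℝ × ℝ => ψ x.1 * η x.2) ⊆ K ×ˢ K' := fun x hx =>
    ⟨hψK fun h => hx (by simp [h]), hηK fun h => hx (by simp [h])⟩
  have hc := hK.prod hK'
  exact ⟨(hψ.comp contDiff_fst).mul (hη.comp contDiff_snd),
    HasCompactSupport.of_support_subset_isCompact hc hs,
    (closure_minimal hs hc.isClosed).trans (prod_mono hKI hKI')⟩

/-- Bounded pointwise convergence implies convergence in `L²(Ω)`. -/
lemma tendsto_ofCont {f : ℕ → C(ℝ × ℝ, ℝ)} {g : C(ℝ × ℝ, ℝ)} {c : ℝ}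
    (hc : ∀ n, ∀ x ∈ Omega, |f n x| ≤ c)
    (h : ∀ x ∈ Omega, Tendsto (fun n => f n x) atTop (𝓝 (g x))) :
    Tendsto (fun n => ofCont (f n)) atTop (𝓝 (ofCont g)) := by
  rw [tendsto_iff_norm_sub_tendsto_zero]
  have h1 : Tendsto (fun n => ∫ x in Omega, (f n - g) x ^ 2) atTop (𝓝 (∫ _ in Omega, (0 : ℝ))) := by
    refine tendsto_integral_of_dominated_convergence (fun _ => (c + c) ^ 2)
      (fun n => ((f n - g).continuous.pow 2).aestronglyMeasurable)
      (integrable_const _) (fun n => ?_) ?_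
    · refine (ae_restrict_iff' measurableSet_Omega).2 (Eventually.of_forall fun x hx => ?_)
      have hg : |g x| ≤ c := le_of_tendsto (h x hx).abs (Eventually.of_forall fun n => hc n x hx)
      rw [Real.norm_eq_abs, abs_pow]
      exact pow_le_pow_left₀ (abs_nonneg _) ((abs_sub _ _).trans (add_le_add (hc n x hx) hg)) 2
    · refine (ae_restrict_iff' measurableSet_Omega).2 (Eventually.of_forall fun x hx => ?_)
      simpa using ((h x hx).sub_const (g x)).pow 2
  simp only [integral_zero, ← norm_sq_ofCont, map_sub] at h1
  simpa [Real.sqrt_sq (norm_nonneg _)] using h1.sqrt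

lemma hasFDerivAt_mul_prod {ψ η : ℝ → ℝ} (hψ : ContDiff ℝ ∞ ψ) (hη : ContDiff ℝ ∞ η) (x : ℝ × ℝ) :
    HasFDerivAt (fun x : ℝ × ℝ => ψ x.1 * η x.2)
      (ψ x.1 • deriv η x.2 • ContinuousLinearMap.snd ℝ ℝ ℝ +
        η x.2 • deriv ψ x.1 • ContinuousLinearMap.fst ℝ ℝ ℝ) x :=
  (((hψ.differentiable (by simp) x.1).hasDerivAt).comp_hasFDerivAt x hasFDerivAt_fst).mul
    (((hη.differentiable (by simp) x.2).hasDerivAt).comp_hasFDerivAt x hasFDerivAt_snd)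

lemma tensor_triple_mem {a b : ℝ[X]} (ha : a.eval 1 = 0) (ha' : a.eval (-1) = 0)
    (hb : b.eval 1 = 0) (hb' : b.eval (-1) = 0) :
    (tensor a b, tensor (derivative a) b, tensor a (derivative b)) ∈
      testTriples.topologicalClosure := by
  obtain ⟨ψ, hψ, hψK, ⟨c, hc⟩, hψ0, hψ1⟩ := exists_testFunction_approx ha ha'
  obtain ⟨η, hη, hηK, ⟨d, hd⟩, hη0, hη1⟩ := exists_testFunction_approx hb hb'
  have hψc : ∀ n, Continuous (ψ n) := fun n => (hψ n).continuous
  have hηc : ∀ n, Continuous (η n) := fun n => (hη n).continuous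
  have hψd : ∀ n, Continuous (deriv (ψ n)) := fun n => (hψ n).continuous_deriv (by simp)
  have hηd : ∀ n, Continuous (deriv (η n)) := fun n => (hη n).continuous_deriv (by simp)
  have key : ∀ (σ τ : ℕ → ℝ → ℝ) (hσ : ∀ n, Continuous (σ n)) (hτ : ∀ n, Continuous (τ n))
      (p r : ℝ[X]), (∀ n, ∀ x ∈ Ioo (-1 : ℝ) 1, |σ n x| ≤ c) →
      (∀ n, ∀ x ∈ Ioo (-1 : ℝ) 1, |τ n x| ≤ d) →
      (∀ x ∈ Ioo (-1 : ℝ) 1, Tendsto (fun n => σ n x) atTop (𝓝 (p.eval x))) →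
      (∀ x ∈ Ioo (-1 : ℝ) 1, Tendsto (fun n => τ n x) atTop (𝓝 (r.eval x))) →
      Tendsto (fun n => ofCont ⟨fun x => σ n x.1 * τ n x.2,
        ((hσ n).comp continuous_fst).mul ((hτ n).comp continuous_snd)⟩) atTop (𝓝 (tensor p r)) := by
    intro σ τ hσ hτ p r hσc hτd hσp hτr
    refine tendsto_ofCont (c := c * d) (fun n x hx => ?_) fun x hx => ?_
    · have hn := mul_le_mul (hσc n x.1 hx.1) (hτd n x.2 hx.2) (abs_nonneg _)
        ((abs_nonneg _).trans (hσc n x.1 hx.1))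
      rwa [← abs_mul] at hn
    · exact (hσp x.1 hx.1).mul (hτr x.2 hx.2)
  refine mem_closure_of_tendsto ((key ψ η hψc hηc a b (fun n x hx => (hc n x hx).1)
    (fun n x hx => (hd n x hx).1) hψ0 hη0).prodMk_nhds
    ((key (fun n => deriv (ψ n)) η hψd hηc _ b (fun n x hx => (hc n x hx).2)
      (fun n x hx => (hd n x hx).1) hψ1 hη0).prodMk_nhds
    (key ψ (fun n => deriv (η n)) hψc hηd a _ (fun n x hx => (hc n x hx).1)
      (fun n x hx => (hd n x hx).2) hψ0 hη1))) (Eventually.of_forall fun n => ?_)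
  refine ⟨fun x => ψ n x.1 * η n x.2, isTestFunction_mul (hψ n) (hη n) (hψK n) (hηK n),
    represents_ofCont _, (represents_ofCont _).congr fun x => ?_,
    (represents_ofCont _).congr fun x => ?_⟩
  · rw [(hasFDerivAt_mul_prod (hψ n) (hη n) x).fderiv]
    simp [mul_comm]
  · rw [(hasFDerivAt_mul_prod (hψ n) (hη n) x).fderiv]
    simp

/-- The element `e_i ⊗ e_j` of `H¹₀(Ω)`, a positive multiple of `Φ_{(i+2, j+2)}`. -/
def basisElem (i j : ℕ) : H10 :=
  ⟨(tensor (primLeg i) (primLeg j), tensor (derivative (primLeg i)) (primLeg j),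
    tensor (primLeg i) (derivative (primLeg j))),
    tensor_triple_mem (primLeg_eval_one i) (primLeg_eval_neg_one i) (primLeg_eval_one j)
      (primLeg_eval_neg_one j)⟩

lemma toL2_basisElem (i j : ℕ) : toL2 (basisElem i j) = tensor (primLeg i) (primLeg j) := rfl

lemma Phi_eq (i j : ℕ) (x : ℝ × ℝ) :
    Phi (i + 2, j + 2) x = Real.sqrt ((i : ℝ) + 3 / 2) * Real.sqrt ((j : ℝ) + 3 / 2) *
      ((primLeg i).eval x.1 * (primLeg j).eval x.2) := by
  rw [Phi, bs_eq, bs_eq]; ring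

lemma represents_Phi (i j : ℕ) :
    Represents (toL2 ((Real.sqrt ((i : ℝ) + 3 / 2) * Real.sqrt ((j : ℝ) + 3 / 2)) • basisElem i j))
      (Phi (i + 2, j + 2)) := by
  rw [map_smul, toL2_basisElem]
  exact ((represents_tensor _ _).smul _).congr fun x => (Phi_eq i j x).symm

lemma eq_smul_basisElem_of_represents_Phi {u : H10} {i j : ℕ}
    (h : Represents (toL2 u) (Phi (i + 2, j + 2))) :
    u = (Real.sqrt ((i : ℝ) + 3 / 2) * Real.sqrt ((j : ℝ) + 3 / 2)) • basisElem i j :=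
  toL2_injective (h.eq (represents_Phi i j))

/-! ### The projection -/

/-- The coefficient of `e_i ⊗ e_j`. It is well defined on `H¹₀(Ω)` (even on `L²(Ω)`) as the
`L_{i+1}'` are dual to the `e_i`. -/
def coef (i j : ℕ) : H10 →ₗ[ℝ] ℝ :=
  (((i : ℝ) + 3 / 2) * ((j : ℝ) + 3 / 2)) •
    (innerₗ L2 (tensor (derivative (legendre (i + 1))) (derivative (legendre (j + 1)))) ∘ₗ toL2)

lemma coef_apply (i j : ℕ) (u : H10) : coef i j u = ((i : ℝ) + 3 / 2) * ((j : ℝ) + 3 / 2) *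
    inner ℝ (tensor (derivative (legendre (i + 1))) (derivative (legendre (j + 1)))) (toL2 u) := rfl

lemma coef_basisElem (i j k l : ℕ) :
    coef i j (basisElem k l) = if k = i ∧ l = j then 1 else 0 := by
  rw [coef_apply, toL2_basisElem, inner_tensor, mul_comm (derivative _), mul_comm (derivative _),
    integ_primLeg_mul_derivative, integ_primLeg_mul_derivative]
  by_cases h1 : k = i
  · by_cases h2 : l = j
    · subst h1 h2
      simp only [if_true, and_self]
      field_simp
    · simp [h2]
  · simp [h1]

/-- The projection of `H¹₀(Ω)` onto `𝒱_{N+4}`, the span of the `e_i ⊗ e_j` with `i + j ≤ N`. -/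
def proj (N : ℕ) : H10 →ₗ[ℝ] H10 :=
  ∑ i ∈ Finset.range (N + 1), ∑ j ∈ Finset.range (N + 1 - i), (coef i j).smulRight (basisElem i j)

lemma proj_apply (N : ℕ) (u : H10) : proj N u =
    ∑ i ∈ Finset.range (N + 1), ∑ j ∈ Finset.range (N + 1 - i), coef i j u • basisElem i j := by
  simp [proj, LinearMap.sum_apply]

lemma proj_basisElem (N k l : ℕ) :
    proj N (basisElem k l) = if k + l ≤ N then basisElem k l else 0 := by
  rw [proj_apply]
  simp only [coef_basisElem]
  split_ifs with h
  · rw [Finset.sum_eq_single_of_mem k (Finset.mem_range.2 (by omega)),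
      Finset.sum_eq_single_of_mem l (Finset.mem_range.2 (by omega))]
    · simp
    · intro j _ hj; simp [hj.symm]
    · intro i _ hi; simp [hi.symm]
  · refine Finset.sum_eq_zero fun i hi => Finset.sum_eq_zero fun j hj => ?_
    rw [if_neg, zero_smul]
    rintro ⟨rfl, rfl⟩
    have h1 := Finset.mem_range.1 hi
    have h2 := Finset.mem_range.1 hj
    omega

lemma coef_eq_fst (i j : ℕ) (u : H10) : coef i j u = -(((i : ℝ) + 3 / 2) * ((j : ℝ) + 3 / 2) *
    inner ℝ (tensor (legendre (i + 1)) (derivative (legendre (j + 1)))) u.1.2.1) := by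
  rw [coef_apply, (inner_tensor_grad u _ _).1, mul_neg, neg_neg]; rfl

lemma coef_eq_snd (i j : ℕ) (u : H10) : coef i j u = -(((i : ℝ) + 3 / 2) * ((j : ℝ) + 3 / 2) *
    inner ℝ (tensor (derivative (legendre (i + 1))) (legendre (j + 1))) u.1.2.2) := by
  rw [coef_apply, (inner_tensor_grad u _ _).2, mul_neg, neg_neg]; rfl

lemma norm_fst_proj_le (N : ℕ) (u : H10) :
    ‖(proj N u).1.2.1‖ ≤ 2 * ((N : ℝ) + 4) * ‖u.1.2.1‖ := by
  refine le_trans (le_of_eq ?_) (norm_truncation_le (T := tensor) inner_tensor u.1.2.1 N)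
  congr 1
  have hg : ∀ v : H10, v.1.2.1 = (LinearMap.fst ℝ L2 L2 ∘ₗ LinearMap.snd ℝ L2 (L2 × L2) ∘ₗ
    testTriples.topologicalClosure.subtype) v := fun _ => rfl
  rw [hg, proj_apply, map_sum]
  refine Finset.sum_congr rfl fun i _ => ?_
  rw [map_sum]
  refine Finset.sum_congr rfl fun j _ => ?_
  rw [map_smul, ← hg, coef_eq_fst]
  simp only [basisElem, derivative_primLeg, map_neg, LinearMap.neg_apply, neg_smul, smul_neg,
    neg_neg]

lemma norm_snd_proj_le (N : ℕ) (u : H10) :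
    ‖(proj N u).1.2.2‖ ≤ 2 * ((N : ℝ) + 4) * ‖u.1.2.2‖ := by
  refine le_trans (le_of_eq ?_) (norm_truncation_le (T := tensor.flip)
    (fun a b c d => by simp only [LinearMap.flip_apply]; rw [inner_tensor, mul_comm]) u.1.2.2 N)
  congr 1
  have hg : ∀ v : H10, v.1.2.2 = (LinearMap.snd ℝ L2 L2 ∘ₗ LinearMap.snd ℝ L2 (L2 × L2) ∘ₗ
    testTriples.topologicalClosure.subtype) v := fun _ => rfl
  rw [hg, proj_apply, map_sum]
  simp only [map_sum]
  rw [Finset.sum_comm' (t' := Finset.range (N + 1)) (s' := fun j => Finset.range (N + 1 - j))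
    (by intro i j; simp only [Finset.mem_range]; omega)]
  refine Finset.sum_congr rfl fun j _ => Finset.sum_congr rfl fun i _ => ?_
  rw [map_smul, ← hg, coef_eq_snd]
  simp only [basisElem, derivative_primLeg, map_neg, LinearMap.flip_apply, neg_smul, smul_neg,
    neg_neg]
  rw [mul_comm ((i : ℝ) + 3 / 2)]

lemma energyNorm_proj_le (N : ℕ) (u : H10) :
    energyNorm (proj N u) ≤ 2 * ((N : ℝ) + 4) * energyNorm u := by
  have h0 : 0 ≤ energyNorm u := norm_nonneg _
  refine le_of_sq_le_sq ?_ (by positivity)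
  rw [mul_pow, energyNorm_sq, energyNorm_sq, mul_add]
  refine add_le_add ?_ ?_
  · rw [← mul_pow]
    exact pow_le_pow_left₀ (norm_nonneg _) (norm_fst_proj_le N u) 2
  · rw [← mul_pow]
    exact pow_le_pow_left₀ (norm_nonneg _) (norm_snd_proj_le N u) 2

lemma derivative_surjective (p : ℝ[X]) : ∃ a : ℝ[X], derivative a = p := by
  have h : Submodule.span ℝ (range legendre) ≤ LinearMap.range (derivative : ℝ[X] →ₗ[ℝ] ℝ[X]) := by
    refine Submodule.span_le.2 ?_
    rintro _ ⟨i, rfl⟩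
    rcases i with _ | i
    · exact ⟨X, by simp [legendre_zero]⟩
    · exact ⟨-primLeg i, by simp [derivative_primLeg]⟩
  exact h (span_range_legendre ▸ Submodule.mem_top)

lemma eq_zero_of_energyNorm_eq_zero {u : H10} (h : energyNorm u = 0) : u = 0 := by
  have h1 : u.1.2.1 = 0 := by
    have := energyNorm_sq u
    rw [h] at this
    exact norm_eq_zero.1 (by nlinarith [sq_nonneg ‖u.1.2.1‖, sq_nonneg ‖u.1.2.2‖])
  refine toL2_injective ?_
  rw [map_zero]
  refine eq_zero_of_inner_tensor_eq_zero fun a b => ?_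
  obtain ⟨a, rfl⟩ := derivative_surjective a
  have h2 := (inner_tensor_grad u a b).1
  rw [h1, inner_zero_right] at h2
  exact neg_eq_zero.1 h2.symm

lemma proj_eq_zero_of_mem_Vc {N : ℕ} {z : H10} (hz : z ∈ Vc (N + 4)) : proj N z = 0 := by
  have hs : Submodule.span ℝ {u : H10 | ∃ m : ℕ × ℕ, 2 ≤ m.1 ∧ 2 ≤ m.2 ∧
      N + 4 < m.1 + m.2 ∧ Represents (toL2 u) (Phi m)} ≤ LinearMap.ker (proj N) := by
    refine Submodule.span_le.2 ?_
    rintro u ⟨⟨m₁, m₂⟩, h1, h2, h3, hu⟩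
    obtain ⟨i, rfl⟩ := Nat.exists_eq_add_of_le' h1
    obtain ⟨j, rfl⟩ := Nat.exists_eq_add_of_le' h2
    rw [SetLike.mem_coe, LinearMap.mem_ker, eq_smul_basisElem_of_represents_Phi hu, map_smul,
      proj_basisElem, if_neg (by simp only at h3; omega), smul_zero]
  refine eq_zero_of_energyNorm_eq_zero (le_antisymm (le_of_forall_pos_le_add fun ε hε => ?_)
    (norm_nonneg _))
  obtain ⟨s, hsS, h⟩ := hz (ε / (2 * ((N : ℝ) + 4))) (by positivity)
  have h1 := energyNorm_proj_le N (z - s)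
  rw [map_sub, LinearMap.mem_ker.1 (hs hsS), sub_zero] at h1
  rw [lt_div_iff₀ (by positivity)] at h
  linarith

/-! ### Polynomials in `H¹₀(Ω)` -/

section Trace

variable {E : Type*} [NormedAddCommGroup E] [InnerProductSpace ℝ E]
  {T : ℝ[X] →ₗ[ℝ] ℝ[X] →ₗ[ℝ] E}

/-- Vanishing of the traces on `x = ±1`. Testing the integration by parts formula with
`L_n ⊗ b`, where `n` exceeds the degree, the side with `L_n'` only sees the boundary values of
the polynomial, while the other side tends to zero with the norm of `L_n`. -/
lemma sum_eval_smul_eq_zero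
    (hT : ∀ a b c d, inner ℝ (T a b) (T c d) = integ (a * c) * integ (b * d))
    {ι : Type*} (s : Finset ι) (a b : ι → ℝ[X]) {g : E}
    (hg : ∀ c d, inner ℝ (T c d) g = -inner ℝ (T (derivative c) d) (∑ k ∈ s, T (a k) (b k))) :
    ∑ k ∈ s, (a k).eval 1 • b k = 0 ∧ ∑ k ∈ s, (a k).eval (-1) • b k = 0 := by
  set P := ∑ k ∈ s, (a k).eval 1 • b k with hP
  set M := ∑ k ∈ s, (a k).eval (-1) • b k with hM
  have key : ∀ d : ℝ[X], integ (P * d) = 0 ∧ integ (M * d) = 0 := by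
    intro d
    have h1 : ∀ᶠ n : ℕ in atTop, integ (P * d) - (-1) ^ n * integ (M * d) =
        -inner ℝ (T (legendre n) d) g := by
      filter_upwards [eventually_gt_atTop (s.sup fun k => (a k).natDegree)] with n hn
      have h2 : ∀ k ∈ s, inner ℝ (T (derivative (legendre n)) d) (T (a k) (b k)) =
          integ (((a k).eval 1 • b k) * d) - (-1) ^ n * integ (((a k).eval (-1) • b k) * d) := by
        intro k hk
        rw [hT, mul_comm (derivative _), mul_comm d, integ_mul_derivative_legendre
          (lt_of_le_of_lt (Finset.le_sup (f := fun k => (a k).natDegree) hk) hn), smul_mul_assoc,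
          smul_mul_assoc, map_smul, map_smul, smul_eq_mul, smul_eq_mul]
        ring
      rw [hg, neg_neg, inner_sum, Finset.sum_congr rfl h2, Finset.sum_sub_distrib,
        ← Finset.mul_sum, hP, hM, Finset.sum_mul, Finset.sum_mul, map_sum, map_sum]
    have h3 : Tendsto (fun n : ℕ => ‖T (legendre n) d‖) atTop (𝓝 0) := by
      have h4 : Tendsto (fun n : ℕ => ‖T (legendre n) d‖ ^ 2) atTop (𝓝 0) := by
        simp only [norm_sq_tensor hT, integ_legendre_mul_self]
        have h5 : Tendsto (fun n : ℕ => 2 * (n : ℝ) + 1) atTop atTop :=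
          (tendsto_natCast_atTop_atTop.const_mul_atTop two_pos).atTop_add tendsto_const_nhds
        simpa using (h5.const_div_atTop 2).mul_const (integ (d * d))
      simpa [Real.sqrt_sq (norm_nonneg _)] using h4.sqrt
    have h6 : Tendsto (fun n : ℕ => integ (P * d) - (-1) ^ n * integ (M * d)) atTop (𝓝 0) := by
      refine squeeze_zero_norm' (h1.mono fun n hn => ?_) (by simpa using h3.mul_const ‖g‖)
      rw [hn, norm_neg]
      exact norm_inner_le_norm _ _
    have h7 : integ (P * d) - integ (M * d) = 0 := by
      have := h6.comp (tendsto_id.const_mul_atTop' (show 0 < 2 by norm_num))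
      refine tendsto_nhds_unique (tendsto_const_nhds.congr fun n => ?_) this
      simp [pow_mul]
    have h8 : integ (P * d) + integ (M * d) = 0 := by
      have := h6.comp ((tendsto_add_atTop_nat 1).comp
        (tendsto_id.const_mul_atTop' (show 0 < 2 by norm_num)))
      refine tendsto_nhds_unique (tendsto_const_nhds.congr fun n => ?_) this
      simp [pow_mul, pow_succ]
    constructor <;> linarith
  exact ⟨eq_zero_of_integ_mul_self_eq_zero (key P).1, eq_zero_of_integ_mul_self_eq_zero (key M).2⟩

end Trace

lemma sum_eq_sum_subInterp {E : Type*} [AddCommGroup E] [Module ℝ E]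
    (T : ℝ[X] →ₗ[ℝ] ℝ[X] →ₗ[ℝ] E) {ι : Type*} (s : Finset ι) (a b : ι → ℝ[X])
    (h1 : ∑ k ∈ s, (a k).eval 1 • b k = 0) (h2 : ∑ k ∈ s, (a k).eval (-1) • b k = 0) :
    ∑ k ∈ s, T (a k) (b k) = ∑ k ∈ s, T (subInterp (a k)) (b k) := by
  rw [← sub_eq_zero, ← Finset.sum_sub_distrib]
  have h : ∀ k ∈ s, T (a k) (b k) - T (subInterp (a k)) (b k) =
      (1 / 2 : ℝ) • (T 1 ((a k).eval 1 • b k) + T 1 ((a k).eval (-1) • b k) +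
        T X ((a k).eval 1 • b k) - T X ((a k).eval (-1) • b k)) := by
    intro k _
    simp only [subInterp_apply, map_sub, map_smul, LinearMap.sub_apply, LinearMap.smul_apply]
    module
  rw [Finset.sum_congr rfl h, ← Finset.smul_sum, Finset.sum_sub_distrib, Finset.sum_add_distrib,
    Finset.sum_add_distrib]
  simp only [← map_sum, h1, h2]
  simp

/-- The span of the `e_i ⊗ e_j` with `i + j ≤ N`. -/
def basisSpan (N : ℕ) : Submodule ℝ H10 :=
  Submodule.span ℝ ((fun m : ℕ × ℕ => basisElem m.1 m.2) '' {m | m.1 + m.2 ≤ N})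

lemma basisElem_mem_basisSpan {N i j : ℕ} (h : i + j ≤ N) : basisElem i j ∈ basisSpan N :=
  Submodule.subset_span ⟨(i, j), h, rfl⟩

lemma proj_eq_self_of_mem_basisSpan {N : ℕ} {u : H10} (hu : u ∈ basisSpan N) : proj N u = u := by
  have h : basisSpan N ≤ LinearMap.eqLocus (proj N) LinearMap.id := by
    refine Submodule.span_le.2 ?_
    rintro _ ⟨m, hm, rfl⟩
    exact (proj_basisElem N m.1 m.2).trans (if_pos hm)
  exact h hu

lemma proj_mem_basisSpan (N : ℕ) (u : H10) : proj N u ∈ basisSpan N := by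
  rw [proj_apply]
  refine Submodule.sum_mem _ fun i hi => Submodule.sum_mem _ fun j hj =>
    Submodule.smul_mem _ _ (basisElem_mem_basisSpan ?_)
  have h1 := Finset.mem_range.1 hi
  have h2 := Finset.mem_range.1 hj
  omega

lemma tensor_subInterp_mem {N k l : ℕ} (h : k + l ≤ N + 4) :
    tensor (subInterp (X ^ k)) (subInterp (X ^ l)) ∈ (basisSpan N).map toL2 := by
  have h1 := Submodule.apply_mem_map₂ tensor (subInterp_mem (d := k) (natDegree_X_pow_le k))
    (subInterp_mem (d := l) (natDegree_X_pow_le l))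
  rw [Submodule.map₂_span_span] at h1
  refine Submodule.span_le.2 ?_ h1
  rintro _ ⟨_, ⟨i, hi, rfl⟩, _, ⟨j, hj, rfl⟩, rfl⟩
  refine ⟨basisElem i j, basisElem_mem_basisSpan ?_, rfl⟩
  have hi : i + 2 ≤ k := hi
  have hj : j + 2 ≤ l := hj
  omega

/-- A polynomial in `H¹₀(Ω)` of total degree at most `N + 4` is a combination of the `e_i ⊗ e_j`
with `i + j ≤ N`: as the traces vanish, the linear interpolants at `±1` in both variables may be
subtracted from every monomial, which does not raise the degree. -/
lemma V_le_basisSpan (N : ℕ) : V (N + 4) ≤ basisSpan N := by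
  rintro u ⟨P, hP, hu⟩
  have hu0 : u.1.1 = ∑ m ∈ P.support, tensor (P.coeff m • X ^ m 0) (X ^ m 1) :=
    (hu.eq (represents_sum_tensor_of_mvPolynomial P)).trans
      (Finset.sum_congr rfl fun m _ => by rw [map_smul, LinearMap.smul_apply])
  obtain ⟨h1, h2⟩ := sum_eval_smul_eq_zero (T := tensor) inner_tensor P.support
    (fun m => P.coeff m • X ^ m 0) (fun m => X ^ m 1) (g := u.1.2.1)
    (fun c d => by rw [← hu0]; exact (inner_tensor_grad u c d).1)
  obtain ⟨h3, h4⟩ := sum_eval_smul_eq_zero (T := tensor.flip)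
    (fun a b c d => by simp only [LinearMap.flip_apply]; rw [inner_tensor, mul_comm]) P.support
    (fun m => X ^ m 1) (fun m => P.coeff m • X ^ m 0) (g := u.1.2.2)
    (fun c d => by
      simp only [LinearMap.flip_apply]
      rw [← hu0]; exact (inner_tensor_grad u d c).2)
  rw [sum_eq_sum_subInterp tensor _ _ _ h1 h2] at hu0
  have h5 := sum_eq_sum_subInterp (tensor ∘ₗ subInterp).flip _ _ _ h3 h4
  simp only [LinearMap.flip_apply, LinearMap.comp_apply] at h5
  rw [h5] at hu0
  have h6 : toL2 u ∈ (basisSpan N).map toL2 := by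
    refine (congrArg (· ∈ (basisSpan N).map toL2) hu0).mpr (Submodule.sum_mem _ fun m hm => ?_)
    rw [map_smul, map_smul, LinearMap.smul_apply]
    refine Submodule.smul_mem _ _ (tensor_subInterp_mem ?_)
    refine le_trans (le_of_eq ?_) ((MvPolynomial.le_totalDegree hm).trans hP)
    rw [Finsupp.sum_fintype _ _ (fun _ => rfl), Fin.sum_univ_two]
  obtain ⟨v, hv, hvu⟩ := h6
  exact toL2_injective hvu ▸ hv

lemma totalDegree_aeval_X_le (a : ℝ[X]) (i : Fin 2) :
    (aeval (MvPolynomial.X i : MvPolynomial (Fin 2) ℝ) a).totalDegree ≤ a.natDegree := by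
  rw [aeval_eq_sum_range]
  refine MvPolynomial.totalDegree_finsetSum_le fun k hk => ?_
  refine (MvPolynomial.totalDegree_smul_le _ _).trans ?_
  rw [MvPolynomial.totalDegree_X_pow]
  exact Nat.lt_succ_iff.1 (Finset.mem_range.1 hk)

lemma eval_aeval_X (a : ℝ[X]) (i : Fin 2) (x : Fin 2 → ℝ) :
    MvPolynomial.eval x (aeval (MvPolynomial.X i : MvPolynomial (Fin 2) ℝ) a) = a.eval (x i) := by
  have h := (Polynomial.aeval_algHom_apply (MvPolynomial.aeval x) (MvPolynomial.X i) a).symm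
  simpa [MvPolynomial.coe_aeval_eq_eval, Polynomial.coe_aeval_eq_eval] using h

lemma basisSpan_le_V (N : ℕ) : basisSpan N ≤ V (N + 4) := by
  refine Submodule.span_le.2 ?_
  rintro _ ⟨⟨i, j⟩, hij, rfl⟩
  refine ⟨aeval (MvPolynomial.X 0) (primLeg i) * aeval (MvPolynomial.X 1) (primLeg j), ?_, ?_⟩
  · have h1 := (totalDegree_aeval_X_le (primLeg i) 0).trans (natDegree_primLeg_le i)
    have h2 := (totalDegree_aeval_X_le (primLeg j) 1).trans (natDegree_primLeg_le j)
    have h3 : i + j ≤ N := hij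
    exact (MvPolynomial.totalDegree_mul _ _).trans (by omega)
  · rw [toL2_basisElem]
    refine (represents_tensor _ _).congr fun x => ?_
    rw [map_mul, eval_aeval_X, eval_aeval_X]
    rfl

lemma proj_eq_self_of_mem_V {N : ℕ} {u : H10} (hu : u ∈ V (N + 4)) : proj N u = u :=
  proj_eq_self_of_mem_basisSpan (V_le_basisSpan N hu)

lemma proj_mem_V (N : ℕ) (u : H10) : proj N u ∈ V (N + 4) :=
  basisSpan_le_V N (proj_mem_basisSpan N u)

/-! ### Density of the Babuška–Shen functions -/

lemma sq_le_two_mul_integral_sq {h r : ℝ → ℝ} (hr : Continuous r)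
    (hd : ∀ y, HasDerivAt h (r y) y) (h0 : h (-1) = 0) {y : ℝ} (hy : y ∈ Ioo (-1 : ℝ) 1) :
    h y ^ 2 ≤ 2 * ∫ t in (-1 : ℝ)..1, r t ^ 2 := by
  have hpos : 0 < y + 1 := by linarith [hy.1]
  have h1 : ∫ t in (-1 : ℝ)..y, r t = h y := by
    rw [intervalIntegral.integral_eq_sub_of_hasDerivAt (fun t _ => hd t)
      (hr.intervalIntegrable _ _), h0, sub_zero]
  set m := h y / (y + 1) with hm
  -- the variance of `r` on `(-1, y)` is nonnegative
  have h2 : 0 ≤ ∫ t in (-1 : ℝ)..y, (r t - m) ^ 2 :=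
    intervalIntegral.integral_nonneg hy.1.le fun t _ => sq_nonneg _
  have h3 : ∫ t in (-1 : ℝ)..y, (r t - m) ^ 2 =
      (∫ t in (-1 : ℝ)..y, r t ^ 2) - 2 * m * h y + (y + 1) * m ^ 2 := by
    have he : ∀ t, (r t - m) ^ 2 = r t ^ 2 - 2 * m * r t + m ^ 2 := fun t => by ring
    simp only [he]
    rw [intervalIntegral.integral_add (Continuous.intervalIntegrable (by fun_prop) _ _)
        (Continuous.intervalIntegrable (by fun_prop) _ _),
      intervalIntegral.integral_sub (Continuous.intervalIntegrable (by fun_prop) _ _)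
        (Continuous.intervalIntegrable (by fun_prop) _ _),
      intervalIntegral.integral_const_mul, h1]
    simp
  have h4 : ∫ t in (-1 : ℝ)..y, r t ^ 2 ≤ ∫ t in (-1 : ℝ)..1, r t ^ 2 := by
    refine intervalIntegral.integral_mono_interval le_rfl hy.1.le hy.2.le
      (Eventually.of_forall fun t => sq_nonneg _)
      (Continuous.intervalIntegrable (by fun_prop) _ _)
  have h5 : h y ^ 2 = (y + 1) * (2 * m * h y - (y + 1) * m ^ 2) := by
    rw [hm]; field_simp; ring
  have h6 : 0 ≤ ∫ t in (-1 : ℝ)..1, r t ^ 2 :=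
    intervalIntegral.integral_nonneg (by norm_num) fun t _ => sq_nonneg _
  calc h y ^ 2 ≤ (y + 1) * ∫ t in (-1 : ℝ)..1, r t ^ 2 := by
        rw [h5]; exact mul_le_mul_of_nonneg_left (by linarith) hpos.le
    _ ≤ _ := mul_le_mul_of_nonneg_right (by linarith [hy.2]) h6

/-- Poincaré's inequality for functions that vanish on the lower side of the square. -/
lemma norm_ofCont_le_of_hasDerivAt_snd {h r : C(ℝ × ℝ, ℝ)}
    (hd : ∀ x y, HasDerivAt (fun y => h (x, y)) (r (x, y)) y) (h0 : ∀ x, h (x, -1) = 0) :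
    ‖ofCont h‖ ≤ 2 * ‖ofCont r‖ := by
  set R : ℝ → ℝ := fun x => ∫ t in (-1 : ℝ)..1, r (x, t) ^ 2 with hR
  have hRc : Continuous R :=
    intervalIntegral.continuous_parametric_intervalIntegral_of_continuous' (by fun_prop) _ _
  have h1 : ∫ x in Omega, h x ^ 2 ≤ ∫ x in Omega, 2 * R x.1 := by
    refine setIntegral_mono_on (integrableOn_of_continuous (by fun_prop))
      (integrableOn_of_continuous (by fun_prop)) measurableSet_Omega fun x hx => ?_
    exact sq_le_two_mul_integral_sq (h := fun y => h (x.1, y)) (r := fun y => r (x.1, y))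
      (by fun_prop) (hd x.1) (h0 x.1) hx.2
  have h2 : ∫ x in Omega, 2 * R x.1 = 4 * ∫ x in Ioo (-1 : ℝ) 1, R x := by
    have := setIntegral_prod_mul (μ := volume) (ν := volume) (fun x => 2 * R x)
      (fun _ : ℝ => (1 : ℝ)) (Ioo (-1 : ℝ) 1) (Ioo (-1 : ℝ) 1)
    simp only [mul_one] at this
    rw [Omega, Measure.volume_eq_prod, this, integral_const_mul, setIntegral_const,
      Real.volume_real_Ioo_of_le (by norm_num)]
    simp only [smul_eq_mul]
    ring
  have h3 : ∫ x in Omega, r x ^ 2 = ∫ x in Ioo (-1 : ℝ) 1, R x := by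
    have := setIntegral_prod (μ := volume) (ν := volume) (fun x : ℝ × ℝ => r x ^ 2)
      (s := Ioo (-1 : ℝ) 1) (t := Ioo (-1 : ℝ) 1) (integrableOn_of_continuous (by fun_prop))
    rw [Omega, Measure.volume_eq_prod, this]
    simp only [hR, intervalIntegral.integral_of_le (show (-1 : ℝ) ≤ 1 by norm_num),
      integral_Ioc_eq_integral_Ioo]
  refine le_of_sq_le_sq ?_ (by positivity)
  rw [mul_pow, norm_sq_ofCont, norm_sq_ofCont, h3]
  linarith

lemma norm_ofCont_comp_swap (f : C(ℝ × ℝ, ℝ)) :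
    ‖ofCont (f.comp ContinuousMap.prodSwap)‖ = ‖ofCont f‖ := by
  have h : ∫ x in Omega, (f.comp ContinuousMap.prodSwap) x ^ 2 = ∫ x in Omega, f x ^ 2 :=
    setIntegral_prod_swap (μ := volume) (ν := volume) (Ioo (-1 : ℝ) 1) (Ioo (-1 : ℝ) 1)
      (fun x => f x ^ 2)
  rw [← norm_sq_ofCont, ← norm_sq_ofCont] at h
  exact (pow_left_inj₀ (norm_nonneg _) (norm_nonneg _) two_ne_zero).1 h

lemma norm_ofCont_le_of_hasDerivAt_fst {h r : C(ℝ × ℝ, ℝ)}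
    (hd : ∀ x y, HasDerivAt (fun x => h (x, y)) (r (x, y)) x) (h0 : ∀ y, h (-1, y) = 0) :
    ‖ofCont h‖ ≤ 2 * ‖ofCont r‖ := by
  rw [← norm_ofCont_comp_swap h, ← norm_ofCont_comp_swap r]
  exact norm_ofCont_le_of_hasDerivAt_snd (fun x y => hd y x) h0

/-- An element of `L²(Ω)` whose means in both variables vanish can be approximated by
combinations of the `L_{i+1} ⊗ L_{j+1}`. -/
lemma exists_mem_span_legendre_succ {F : L2} (h1 : ∀ b, inner ℝ (tensor 1 b) F = 0)
    (h2 : ∀ a, inner ℝ (tensor a 1) F = 0) {ε : ℝ} (hε : 0 < ε) :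
    ∃ s ∈ Submodule.span ℝ (range fun m : ℕ × ℕ =>
      tensor (legendre (m.1 + 1)) (legendre (m.2 + 1))), ‖F - s‖ < ε := by
  set U₁ := Submodule.span ℝ (range fun m : ℕ × ℕ =>
      tensor (legendre (m.1 + 1)) (legendre (m.2 + 1))) with hU₁
  set U₀ := Submodule.span ℝ
    ((fun m : ℕ × ℕ => tensor (legendre m.1) (legendre m.2)) '' {m | m.1 = 0 ∨ m.2 = 0}) with hU₀
  have hle : legendreSpan ≤ U₀ ⊔ U₁ := by
    refine Submodule.span_le.2 ?_
    rintro _ ⟨⟨i, j⟩, rfl⟩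
    by_cases h : i = 0 ∨ j = 0
    · exact Submodule.mem_sup_left (Submodule.subset_span ⟨(i, j), h, rfl⟩)
    · push Not at h
      obtain ⟨i, rfl⟩ := Nat.exists_eq_succ_of_ne_zero h.1
      obtain ⟨j, rfl⟩ := Nat.exists_eq_succ_of_ne_zero h.2
      exact Submodule.mem_sup_right (Submodule.subset_span ⟨(i, j), rfl⟩)
  have horth : U₀ ⟂ U₁ := by
    refine Submodule.isOrtho_span.2 ?_
    rintro _ ⟨⟨i, j⟩, h, rfl⟩ _ ⟨⟨k, l⟩, rfl⟩
    simp only [mem_ofPred_eq] at h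
    simp only [inner_tensor]
    rcases h with rfl | rfl
    · rw [integ_legendre_mul_legendre (by omega), zero_mul]
    · rw [integ_legendre_mul_legendre (Nat.succ_ne_zero l).symm, mul_zero]
  have hF : ∀ s ∈ U₀, inner ℝ s F = 0 := by
    intro s hs
    induction hs using Submodule.span_induction with
    | mem x hx =>
      obtain ⟨⟨i, j⟩, h, rfl⟩ := hx
      simp only [mem_ofPred_eq] at h
      rcases h with rfl | rfl
      · simp only [legendre_zero]; exact h1 _
      · simp only [legendre_zero]; exact h2 _
    | zero => exact inner_zero_left _
    | add x y _ _ hx hy => rw [inner_add_left, hx, hy, add_zero]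
    | smul c x _ hx => rw [real_inner_smul_left, hx, mul_zero]
  obtain ⟨s, hs, hsF⟩ := exists_mem_legendreSpan_norm_sub_lt F hε
  obtain ⟨s₀, hs₀, s₁, hs₁, rfl⟩ := Submodule.mem_sup.1 (hle hs)
  refine ⟨s₁, hs₁, lt_of_le_of_lt ?_ hsF⟩
  -- Pythagoras: dropping `s₀`, which is orthogonal to `F - s₁`, reduces the distance
  have h3 : inner ℝ (F - s₁) s₀ = 0 := by
    rw [inner_sub_left, real_inner_comm, hF s₀ hs₀, real_inner_comm, horth.inner_eq hs₀ hs₁,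
      sub_zero]
  have h4 := norm_sub_sq_real (F - s₁) s₀
  rw [h3, sub_sub, add_comm s₁] at h4
  exact le_of_sq_le_sq (by nlinarith [sq_nonneg ‖s₀‖]) (norm_nonneg _)

lemma IsTestFunction.fderiv_comm {f : ℝ × ℝ → ℝ} (hf : IsTestFunction f) (x v w : ℝ × ℝ) :
    fderiv ℝ (fun y => fderiv ℝ f y v) x w = fderiv ℝ (fun y => fderiv ℝ f y w) x v := by
  have hd : DifferentiableAt ℝ (fderiv ℝ f) x :=
    (hf.smooth.fderiv_right (m := 1) (by norm_cast)).differentiable (by simp) x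
  have h : IsSymmSndFDerivAt ℝ f x := hf.smooth.contDiffAt.isSymmSndFDerivAt (by
    simpa using WithTop.coe_le_coe.2 (le_top : (2 : ℕ∞) ≤ ⊤))
  have h1 : ∀ v, fderiv ℝ (fun y => fderiv ℝ f y v) x = (fderiv ℝ (fderiv ℝ f) x).flip v := by
    intro v
    rw [fderiv_clm_apply hd (differentiableAt_const v)]
    simp
  rw [h1, h1]
  exact h.eq w v

lemma hasDerivAt_comp_snd {f : ℝ × ℝ → ℝ} (hf : ContDiff ℝ ∞ f) (x y : ℝ) :
    HasDerivAt (fun y => f (x, y)) (fderiv ℝ f (x, y) (0, 1)) y :=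
  ((hf.differentiable (by simp) (x, y)).hasFDerivAt).comp_hasDerivAt y
    ((hasDerivAt_const y x).prodMk (hasDerivAt_id y))

lemma hasDerivAt_comp_fst {f : ℝ × ℝ → ℝ} (hf : ContDiff ℝ ∞ f) (x y : ℝ) :
    HasDerivAt (fun x => f (x, y)) (fderiv ℝ f (x, y) (1, 0)) x :=
  ((hf.differentiable (by simp) (x, y)).hasFDerivAt).comp_hasDerivAt x
    ((hasDerivAt_id x).prodMk (hasDerivAt_const x y))

/-- A test function `f` is approximated by the combination `g` of the `e_i ⊗ e_j` whose mixed
derivative `∂₁∂₂g` approximates `∂₁∂₂f` in `L²(Ω)`. -/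
lemma exists_mem_span_basisElem_near_testFunction (u : H10) (hu : u.1 ∈ testTriples) {ε : ℝ}
    (hε : 0 < ε) :
    ∃ g ∈ Submodule.span ℝ (range fun m : ℕ × ℕ => basisElem m.1 m.2), energyNorm (u - g) < ε := by
  obtain ⟨f, hf, -, hu1, hu2⟩ := hu
  have hf1 := hf.fderiv_apply (1, 0)
  have hf2 := hf.fderiv_apply (0, 1)
  have hf12 := hf1.fderiv_apply (0, 1)
  let F₁ : C(ℝ × ℝ, ℝ) := ⟨_, hf1.smooth.continuous⟩
  let F₂ : C(ℝ × ℝ, ℝ) := ⟨_, hf2.smooth.continuous⟩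
  let F : C(ℝ × ℝ, ℝ) := ⟨_, hf12.smooth.continuous⟩
  have hF : ∀ x, F x = fderiv ℝ (fun y => fderiv ℝ f y (0, 1)) x (1, 0) := fun x =>
    hf.fderiv_comm x _ _
  have hFa : ∀ a, inner ℝ (tensor a 1) (ofCont F) = 0 := by
    intro a
    rw [tensor_apply, inner_ofCont_eq_integral _ (represents_ofCont F)]
    refine (hf1.integral_mul_fderiv (contDiff_tensorFun a 1) (0, 1)).trans ?_
    simp [fderiv_tensorFun_snd]
  have hFb : ∀ b, inner ℝ (tensor 1 b) (ofCont F) = 0 := by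
    intro b
    rw [tensor_apply, inner_ofCont_eq_integral _ ((represents_ofCont F).congr hF)]
    refine (hf2.integral_mul_fderiv (contDiff_tensorFun 1 b) (1, 0)).trans ?_
    simp [fderiv_tensorFun_fst]
  obtain ⟨s, hs, hsF⟩ := exists_mem_span_legendre_succ hFb hFa (show 0 < ε / 3 by positivity)
  obtain ⟨c, rfl⟩ := Finsupp.mem_span_range_iff_exists_finsupp.1 hs
  set g : H10 := ∑ m ∈ c.support, c m • basisElem m.1 m.2 with hg
  -- the error `f - g` in `∂₁`, `∂₂` and `∂₁∂₂`
  let r : C(ℝ × ℝ, ℝ) :=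
    F - ∑ m ∈ c.support, c m • tensorFun (legendre (m.1 + 1)) (legendre (m.2 + 1))
  let h₁ : C(ℝ × ℝ, ℝ) :=
    F₁ - ∑ m ∈ c.support, c m • tensorFun (derivative (primLeg m.1)) (primLeg m.2)
  let h₂ : C(ℝ × ℝ, ℝ) :=
    F₂ - ∑ m ∈ c.support, c m • tensorFun (primLeg m.1) (derivative (primLeg m.2))
  have hr : ‖ofCont r‖ < ε / 3 := by
    refine lt_of_le_of_lt (le_of_eq ?_) hsF
    rw [map_sub, map_sum, Finsupp.sum]
    simp only [map_smul, tensor_apply]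
  have hr_apply : ∀ x, r x = F x -
      ∑ m ∈ c.support, c m * ((legendre (m.1 + 1)).eval x.1 * (legendre (m.2 + 1)).eval x.2) := by
    intro x; simp [r]
  have hg1 : (u - g).1.2.1 = ofCont h₁ := by
    have hl : ∀ v : H10, v.1.2.1 = (LinearMap.fst ℝ L2 L2 ∘ₗ LinearMap.snd ℝ L2 (L2 × L2) ∘ₗ
      testTriples.topologicalClosure.subtype) v := fun _ => rfl
    rw [hl, map_sub, hg, map_sum, map_sub, map_sum, ← hl, hu1.eq (represents_ofCont F₁)]
    simp only [map_smul, ← hl]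
    rfl
  have hg2 : (u - g).1.2.2 = ofCont h₂ := by
    have hl : ∀ v : H10, v.1.2.2 = (LinearMap.snd ℝ L2 L2 ∘ₗ LinearMap.snd ℝ L2 (L2 × L2) ∘ₗ
      testTriples.topologicalClosure.subtype) v := fun _ => rfl
    rw [hl, map_sub, hg, map_sum, map_sub, map_sum, ← hl, hu2.eq (represents_ofCont F₂)]
    simp only [map_smul, ← hl]
    rfl
  have n1 : ‖ofCont h₁‖ ≤ 2 * ‖ofCont r‖ := by
    refine norm_ofCont_le_of_hasDerivAt_snd (fun x y => ?_) fun x => ?_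
    · have hd := (hasDerivAt_comp_snd hf1.smooth x y).sub
        (HasDerivAt.fun_sum (u := c.support) fun m _ =>
          ((primLeg m.2).hasDerivAt y).const_mul (c m * (derivative (primLeg m.1)).eval x))
      refine (hd.congr_of_eventuallyEq (Eventually.of_forall fun y => ?_)).congr_deriv ?_
      · simp [h₁, F₁, mul_assoc]
      · rw [hr_apply]; simp [derivative_primLeg, mul_assoc, F]
    · have h0 : F₁ (x, -1) = 0 := hf1.eq_zero_of_notMem fun h => lt_irrefl _ h.2.1
      simp [h₁, h0, primLeg_eval_neg_one]
  have n2 : ‖ofCont h₂‖ ≤ 2 * ‖ofCont r‖ := by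
    refine norm_ofCont_le_of_hasDerivAt_fst (fun x y => ?_) fun y => ?_
    · have hd := (hasDerivAt_comp_fst hf2.smooth x y).sub
        (HasDerivAt.fun_sum (u := c.support) fun m _ =>
          ((primLeg m.1).hasDerivAt x).const_mul (c m * (derivative (primLeg m.2)).eval y))
      refine (hd.congr_of_eventuallyEq (Eventually.of_forall fun x => ?_)).congr_deriv ?_
      · simp [h₂, F₂, mul_assoc, mul_comm]
      · rw [hr_apply, hF]; simp [derivative_primLeg, mul_assoc, mul_comm]
    · have h0 : F₂ (-1, y) = 0 := hf2.eq_zero_of_notMem fun h => lt_irrefl _ h.1.1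
      simp [h₂, h0, primLeg_eval_neg_one]
  refine ⟨g, Submodule.sum_mem _ fun m _ => Submodule.smul_mem _ _
    (Submodule.subset_span ⟨m, rfl⟩), ?_⟩
  have h3 : energyNorm (u - g) ≤ 3 * ‖ofCont r‖ := by
    refine le_of_sq_le_sq ?_ (by positivity)
    rw [energyNorm_sq, hg1, hg2]
    nlinarith [norm_nonneg (ofCont h₁), norm_nonneg (ofCont h₂), norm_nonneg (ofCont r)]
  linarith

lemma energyNorm_add_le (u v : H10) : energyNorm (u + v) ≤ energyNorm u + energyNorm v := by
  simpa [energyNorm] using norm_add_le (grad u) (grad v)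

lemma energyNorm_sub_le (u v : H10) : energyNorm (u - v) ≤ energyNorm u + energyNorm v := by
  simpa [energyNorm] using norm_sub_le (grad u) (grad v)

lemma exists_mem_span_basisElem_near (u : H10) {ε : ℝ} (hε : 0 < ε) :
    ∃ g ∈ Submodule.span ℝ (range fun m : ℕ × ℕ => basisElem m.1 m.2), energyNorm (u - g) < ε := by
  obtain ⟨w, hw, hwu⟩ := Metric.mem_closure_iff.1 u.2 (ε / 4) (by positivity)
  let w' : H10 := ⟨w, testTriples.le_topologicalClosure hw⟩
  obtain ⟨g, hg, hgw⟩ := exists_mem_span_basisElem_near_testFunction w' hw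
    (show 0 < ε / 2 by positivity)
  refine ⟨g, hg, ?_⟩
  rw [dist_eq_norm] at hwu
  have h1 : ‖(u - w').1.2.1‖ ≤ ‖(u : L2 × L2 × L2) - w‖ :=
    (norm_fst_le ((u : L2 × L2 × L2) - w).2).trans (norm_snd_le _)
  have h2 : ‖(u - w').1.2.2‖ ≤ ‖(u : L2 × L2 × L2) - w‖ :=
    (norm_snd_le ((u : L2 × L2 × L2) - w).2).trans (norm_snd_le _)
  have h3 : energyNorm (u - w') ≤ 2 * ‖(u : L2 × L2 × L2) - w‖ := by
    refine le_of_sq_le_sq ?_ (by positivity)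
    rw [energyNorm_sq]
    nlinarith [norm_nonneg (u - w').1.2.1, norm_nonneg (u - w').1.2.2]
  have h4 := energyNorm_add_le (u - w') (w' - g)
  rw [sub_add_sub_cancel] at h4
  linarith

lemma sub_proj_mem_Vc (N : ℕ) (u : H10) : u - proj N u ∈ Vc (N + 4) := by
  intro ε hε
  obtain ⟨g, hg, hgu⟩ := exists_mem_span_basisElem_near u
    (show 0 < ε / (1 + 2 * ((N : ℝ) + 4)) by positivity)
  refine ⟨g - proj N g, ?_, ?_⟩
  · have hle : Submodule.span ℝ (range fun m : ℕ × ℕ => basisElem m.1 m.2) ≤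
        (Submodule.span ℝ {u : H10 | ∃ m : ℕ × ℕ, 2 ≤ m.1 ∧ 2 ≤ m.2 ∧ N + 4 < m.1 + m.2 ∧
          Represents (toL2 u) (Phi m)}).comap (LinearMap.id - proj N) := by
      refine Submodule.span_le.2 ?_
      rintro _ ⟨⟨i, j⟩, rfl⟩
      simp only [SetLike.mem_coe, Submodule.mem_comap, LinearMap.sub_apply, LinearMap.id_apply,
        proj_basisElem]
      split_ifs with h
      · rw [sub_self]; exact Submodule.zero_mem _
      · rw [sub_zero]
        have hc : Real.sqrt ((i : ℝ) + 3 / 2) * Real.sqrt ((j : ℝ) + 3 / 2) ≠ 0 := by positivity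
        rw [← inv_smul_smul₀ hc (basisElem i j)]
        exact Submodule.smul_mem _ _ (Submodule.subset_span
          ⟨(i + 2, j + 2), by simp, by simp, by simp only; omega, represents_Phi i j⟩)
    exact hle hg
  · have h1 : u - proj N u - (g - proj N g) = (u - g) - proj N (u - g) := by
      rw [map_sub]; abel
    have h2 := energyNorm_sub_le (u - g) (proj N (u - g))
    have h3 := energyNorm_proj_le N (u - g)
    rw [lt_div_iff₀ (by positivity)] at hgu
    rw [h1]
    linarith

end BabuskaShen

end

theorem proposition4p2 :
    (∀ q : ℕ, 4 ≤ q → IsCompl (BabuskaShen.V q) (BabuskaShen.Vc q)) ∧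
    ∃ C₂ : ℝ, 0 < C₂ ∧ ∀ q : ℕ, 4 ≤ q →
      ∀ vq ∈ BabuskaShen.V q, ∀ zq ∈ BabuskaShen.Vc q,
        BabuskaShen.energyNorm zq ≤ C₂ * (q : ℝ) * BabuskaShen.energyNorm (vq + zq) := by
  open BabuskaShen in
  refine ⟨fun q hq => ?_, 3, by norm_num, fun q hq v hv z hz => ?_⟩
  · obtain ⟨N, rfl⟩ := Nat.exists_eq_add_of_le' hq
    refine isCompl_iff.2 ⟨Submodule.disjoint_def.2 fun u hu hu' => ?_,
      codisjoint_iff.2 (eq_top_iff.2 fun u _ => ?_)⟩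
    · rw [← proj_eq_self_of_mem_V hu, proj_eq_zero_of_mem_Vc hu']
    · rw [← add_sub_cancel (proj N u) u]
      exact Submodule.add_mem_sup (proj_mem_V N u) (sub_proj_mem_Vc N u)
  · obtain ⟨N, rfl⟩ := Nat.exists_eq_add_of_le' hq
    have h1 : proj N (v + z) = v := by
      rw [map_add, proj_eq_self_of_mem_V hv, proj_eq_zero_of_mem_Vc hz, add_zero]
    have h2 := energyNorm_sub_le (v + z) (proj N (v + z))
    have h3 := energyNorm_proj_le N (v + z)
    rw [h1, add_sub_cancel_left] at h2
    rw [h1] at h3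
    have h4 : 0 ≤ energyNorm (v + z) := norm_nonneg _
    have h5 : (0 : ℝ) ≤ N := Nat.cast_nonneg N
    push_cast
    nlinarith [mul_nonneg h5 h4]
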